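/- **Theorem 1.4.** Let $V$ be an $n$-element set and let $\mathrm{sd}(2^V)$ be the barycentric subdivision of the $(n-1)$-dimensional simplex $2^V$, i.e. the simplicial complex whose faces are the chains (under inclusion) of nonempty subsets of $V$, including the empty chain. The carrier of a chain is its largest element ($\varnothing$ for the empty chain), and for $F\subseteq V$ the restriction $\mathrm{sd}(2^V)_F$ is the subcomplex of chains with carrier contained in $F$. For a simplicial complex $\Delta$ of dimension $d-1$ put $h(\Delta,x)=\sum_{E\in\Delta}x^{|E|}(1-x)^{d-|E|}$, and let $$\ell_V(\mathrm{sd}(2^V),x)=\sum_{F\subseteq V}(-1)^{n-|F|}\,h(\mathrm{sd}(2^V)_F,x)$$ be the local $h$-polynomial. Then there are unique integers $\xi_0,\dots,\xi_{\lfloor n/2\rfloor}$ (the local $\gamma$-vector of $\mathrm{sd}(2^V)$) such that $$\ell_V(\mathrm{sd}(2^V),x)=\sum_{i=0}^{\lfloor n/2\rfloor}\xi_i\,x^i(1+x)^{n-2i},$$ and for every $0\le i\le\lfloor n/2\rfloor$ the number $\xi_i$ is equal to each of the following: * (i) the number of permutations $w$ of $\{1,\dots,n\}$ with exactly $i$ ascending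 runs and no ascending run of length one, where an ascending run is a maximal nonempty string $\{a,a+1,\dots,b\}\subseteq\{1,\dots,n\}$ such that $w(a)<w(a+1)<\cdots<w(b)$, and its length is $b-a+1$; * (ii) the number of derangements (permutations without fixed points) $w$ of $\{1,\dots,n\}$ with exactly $i$ excedances and no double excedance, where $j$ is an excedance if $w(j)>j$ and a double excedance if $w(j)>j>w^{-1}(j)$; * (iii) the number of permutations $w$ of $\{1,\dots,n\}$ with exactly $i$ descents and no double descent, such that every left-to-right maximum is a descent, where $1\le j\le n-1$ is a descent if $w(j)>w(j+1)$, $2\le j\le n-1$ is a double descent if $w(j-1)>w(j)>w(j+1)$, and $1\le j\le n$ is a left-to-right maximum if $w(k)<w(j)$ for all $1\le k<j$. In particular, $\xi_i\ge 0$ for all $0\le i\le\lfloor n/2\rfloor$. Moreover, the derangement polynomial $\sum_w x^{\mathrm{exc}(w)}$, where $w$ runs over the derangements of $\{1,\dots,n\}$ and $\mathrm{exc}(w)$ is the number of excedances of $w$, is unimodal: its coefficients increase weakly up to some index and decrease weakly from there on. -/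

import Mathlib

namespace LocalGamma

open Polynomial

/-! ### Finite simplicial complexes and their `h`-polynomials -/

/-- A finite abstract simplicial complex on the ground set `Ω`: a finite collection of finite
subsets of `Ω`, closed under taking subsets. The empty set counts as a face, and
elements of `Ω` need not be vertices. -/
structure FinComplex (Ω : Type*) where
  faces : Finset (Finset Ω)
  down_closed : ∀ F G : Finset Ω, G ∈ faces → F ⊆ G → F ∈ faces

/-- The simplex `2^V` of all subsets of the finite set `V`. -/
def simplex (V : Type*) [Fintype V] : FinComplex V where
  faces := Finset.univ
  down_closed _ _ _ _ := Finset.mem_univ _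

/-- The number `d = dim Δ + 1`, that is, the maximum cardinality of a face. -/
def FinComplex.rank {Ω : Type*} (Δ : FinComplex Ω) : ℕ :=
  Δ.faces.sup Finset.card

/-- The `h`-polynomial `∑_{F ∈ Δ} x^|F| (1 - x)^(d - |F|)`, where `d = dim Δ + 1`. -/
noncomputable def FinComplex.hPoly {Ω : Type*} (Δ : FinComplex Ω) : ℤ[X] :=
  ∑ F ∈ Δ.faces, X ^ F.card * (1 - X) ^ (Δ.rank - F.card)

/-- The restriction `Γ_F = σ⁻¹(2^F)` of `Γ` to `F ⊆ V`, for a (monotone) carrier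
map `σ` from the faces of `Γ` to the subsets of `V`. -/
def FinComplex.restrict {Ω V : Type*} [DecidableEq V] (Γ : FinComplex Ω)
    (σ : Finset Ω → Finset V) (hσ : Monotone σ) (F : Finset V) : FinComplex Ω where
  faces := Γ.faces.filter (fun E => σ E ⊆ F)
  down_closed A B hB hAB := by
    rw [Finset.mem_filter] at hB ⊢
    exact ⟨Γ.down_closed A B hB.1 hAB, (hσ hAB).trans hB.2⟩

/-- The local `h`-polynomial `∑_{F ⊆ V} (-1)^(|V| - |F|) h(Γ_F, x)` of the complex `Γ`
with carrier map `σ`. -/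
noncomputable def localHPoly {Ω V : Type*} [Fintype V] [DecidableEq V] (Γ : FinComplex Ω)
    (σ : Finset Ω → Finset V) (hσ : Monotone σ) : ℤ[X] :=
  ∑ F : Finset V, (-1) ^ (Fintype.card V - F.card) * (Γ.restrict σ hσ F).hPoly

/-- `ξ = (ξ_0, …, ξ_{⌊n/2⌋})` is the `γ`-vector of `p` with respect to `n`:
`p = ∑_i ξ_i x^i (1 + x)^(n - 2i)`. -/
def IsGammaVector (n : ℕ) (p : ℤ[X]) (ξ : Fin (n / 2 + 1) → ℤ) : Prop :=
  p = ∑ i : Fin (n / 2 + 1), C (ξ i) * X ^ (i : ℕ) * (1 + X) ^ (n - 2 * (i : ℕ))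

/-! ### The barycentric subdivision -/

/-- The barycentric subdivision of `Δ`: its vertices are the nonempty faces of `Δ` and its
faces are the chains (with respect to inclusion) of nonempty faces of `Δ`. -/
def FinComplex.barycentric {Ω : Type*} [DecidableEq Ω] (Δ : FinComplex Ω) :
    FinComplex (Finset Ω) where
  faces := Δ.faces.powerset.filter
    (fun E => ∅ ∉ E ∧ ∀ A ∈ E, ∀ B ∈ E, A ⊆ B ∨ B ⊆ A)
  down_closed E E' hE' h := by
    rw [Finset.mem_filter, Finset.mem_powerset] at hE' ⊢
    exact ⟨h.trans hE'.1, fun h0 => hE'.2.1 (h h0),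
      fun A hA B hB => hE'.2.2 A (h hA) B (h hB)⟩

/-- The carrier of a chain of subsets of `V`: its union, that is, its largest element
(and the empty set for the empty chain). -/
def chainCarrier {V : Type*} [DecidableEq V] (E : Finset (Finset V)) : Finset V :=
  E.sup id

theorem chainCarrier_mono {V : Type*} [DecidableEq V] :
    Monotone (chainCarrier : Finset (Finset V) → Finset V) :=
  fun _ _ h => Finset.sup_mono h

/-- The local `h`-polynomial of the barycentric subdivision of the simplex `2^V`. -/
noncomputable def baryLocalHPoly (V : Type*) [Fintype V] [DecidableEq V] : ℤ[X] :=
  localHPoly (simplex V).barycentric chainCarrier chainCarrier_mono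

/-! ### Permutation statistics

Permutations of `{1, …, n}` are modelled by `Equiv.Perm (Fin n)`, with positions and values
shifted by one. -/

/-- `i` is a descent of `w`: `i + 1` is a position and `w(i) > w(i + 1)`. -/
def IsDescent {n : ℕ} (w : Equiv.Perm (Fin n)) (i : Fin n) : Prop :=
  ∃ k : Fin n, (i : ℕ) + 1 = k ∧ w k < w i

/-- `i` is a double descent of `w`: `i - 1` and `i + 1` are positions and
`w(i - 1) > w(i) > w(i + 1)`. -/
def IsDoubleDescent {n : ℕ} (w : Equiv.Perm (Fin n)) (i : Fin n) : Prop :=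
  ∃ j k : Fin n, (j : ℕ) + 1 = i ∧ (i : ℕ) + 1 = k ∧ w i < w j ∧ w k < w i

/-- `j` is a left to right maximum of `w`. -/
def IsLeftToRightMax {n : ℕ} (w : Equiv.Perm (Fin n)) (j : Fin n) : Prop :=
  ∀ i : Fin n, i < j → w i < w j

/-- `i` is an excedance of `w`. -/
def IsExcedance {n : ℕ} (w : Equiv.Perm (Fin n)) (i : Fin n) : Prop :=
  i < w i

/-- `i` is a double excedance of `w`: `w(i) > i > w⁻¹(i)`. -/
def IsDoubleExcedance {n : ℕ} (w : Equiv.Perm (Fin n)) (i : Fin n) : Prop :=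
  i < w i ∧ w⁻¹ i < i

/-- `S` is an ascending run of `w`: a maximal nonempty string `{i, i + 1, …, j}` of positions on
which `w` is increasing. -/
def IsRun {n : ℕ} (w : Equiv.Perm (Fin n)) (S : Finset (Fin n)) : Prop :=
  Maximal (fun T : Finset (Fin n) =>
    ∃ i j : Fin n, i ≤ j ∧ T = Finset.Icc i j ∧ StrictMonoOn w (T : Set (Fin n))) S

/-- The number of descents. -/
noncomputable def des {n : ℕ} (w : Equiv.Perm (Fin n)) : ℕ := {i | IsDescent w i}.ncard

/-- The number of excedances. -/
noncomputable def exc {n : ℕ} (w : Equiv.Perm (Fin n)) : ℕ := {i | IsExcedance w i}.ncard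

/-- The number of ascending runs. -/
noncomputable def runs {n : ℕ} (w : Equiv.Perm (Fin n)) : ℕ := {S | IsRun w S}.ncard

/-- The derangement polynomial `∑ x^(exc w)`, over the derangements `w` of `n` letters. -/
noncomputable def derangementPoly (n : ℕ) : ℤ[X] :=
  ∑ w : derangements (Fin n), X ^ exc (w : Equiv.Perm (Fin n))

/-- The coefficient sequence of `p` is unimodal: it increases weakly up to some index and
decreases weakly from there on. -/
def IsUnimodal (p : ℤ[X]) : Prop :=
  ∃ m : ℕ, MonotoneOn p.coeff (Set.Iic m) ∧ AntitoneOn p.coeff (Set.Ici m)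

end LocalGamma

namespace LocalGamma

open Polynomial

/-! ### The numbers `ξ_{n,i}` and the insertion recurrence -/

/-! Put G_n = ∑ ξ_{n,i} x^i s^(n-2i). The recurrence of `gammaNum` says that G_{n+1} = D G_n + n x
G_{n-1} for every derivation D with D x = x s and D s = 2x (`gammaSum_succ`). If moreover D f = x,
then E_n = ∑ C(n,k) f^k G_{n-k} is the solution of E_0 = 1, E_{n+1} = D E_n + f E_n
(`insertion_eq_sum`).

That recurrence describes the insertion of a new smallest letter. Mark valleys by x, letters passed
upwards by a, letters passed downwards by b, peaks by 1, and by f the fixed points of a cycle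
structure or, in a word, the left-to-right maxima passed upwards. An insertion that creates a valley
changes the type of exactly one old letter, and D x = x(a+b), D a = D b = D f = x lists the possible
changes; the one remaining insertion contributes the factor f. So cycles and words have the same
generating function E_n with s = a+b, and f = 0 leaves G_n(x, a+b). Taking x = X, a = X, b = 1 gives
the derangement polynomial; (a,b) = (0,1) or (1,0) gives s = 1 and hence the three counts of the
theorem.

On the geometric side, sorting chains by carrier shows that the polynomials h(sd(2^F)) satisfy the
Eulerian recurrence (`hPoly_restrict_recurrence`). So does ∑_{G ⊆ F} G_{|G|}(X, 1+X), again by an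
insertion argument (`eulerian_recurrence`). Möbius inversion then gives ℓ_V = G_n(X, 1+X).
Unimodality follows from ξ ≥ 0, because every x^i(1+x)^(n-2i) is unimodal with the same centre n/2.
-/

/-- The entries of the local `γ`-vector of the barycentric subdivision of the simplex on `n`
vertices, given by their recurrence. -/
def gammaNum : ℕ → ℕ → ℕ
  | 0, 0 => 1
  | 0, _ + 1 => 0
  | 1, _ => 0
  | _ + 2, 0 => 0
  | n + 2, i + 1 => (i + 1) * gammaNum (n + 1) (i + 1) +
      2 * (n + 1 - 2 * i) * gammaNum (n + 1) i + (n + 1) * gammaNum n i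

theorem gammaNum_eq_zero : ∀ {n i : ℕ}, n < 2 * i → gammaNum n i = 0
  | 0, 0, h => by omega
  | 0, _ + 1, _ => by simp [gammaNum]
  | 1, _, _ => by simp [gammaNum]
  | _ + 2, 0, h => by omega
  | n + 2, i + 1, h => by
    have h1 : gammaNum (n + 1) (i + 1) = 0 := gammaNum_eq_zero (by omega)
    have h2 : n + 1 - 2 * i = 0 := by omega
    have h3 : gammaNum n i = 0 := gammaNum_eq_zero (by omega)
    simp [gammaNum, h1, h2, h3]

/-- The polynomial `∑ ξ_{n,i} x^i s^(n - 2i)`. -/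
def gammaSum {R : Type*} [CommRing R] (x s : R) (n : ℕ) : R :=
  ∑ i ∈ Finset.range (n + 1), (gammaNum n i : R) * (x ^ i * s ^ (n - 2 * i))

section Derivation

variable {K R : Type*} [CommRing K] [CommRing R] [Algebra K R] (D : Derivation K R R)

theorem derivation_monomial {x s : R} (hx : D x = x * s) (hs : D s = 2 * x) (i m : ℕ) :
    D (x ^ i * s ^ m) = i * (x ^ i * s ^ (m + 1)) + (2 * m : ℕ) * (x ^ (i + 1) * s ^ (m - 1)) := by
  rcases i with _ | i <;> rcases m with _ | m <;>
    simp [D.leibniz, D.leibniz_pow, hx, hs] <;> ring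

/-- The two terms of `derivation_monomial` give the first two terms of the recurrence of `gammaNum`;
the third is the summand with G_{n-1}. -/
theorem gammaSum_succ {x s : R} (hx : D x = x * s) (hs : D s = 2 * x) :
    ∀ n : ℕ, gammaSum x s (n + 1) = D (gammaSum x s n) + n * x * gammaSum x s (n - 1)
  | 0 => by simp [gammaSum, gammaNum]
  | n + 1 => by
    have key : D (gammaSum x s (n + 1)) =
        ∑ i ∈ Finset.range (n + 2), ((i + 1 : ℕ) * gammaNum (n + 1) (i + 1) : R) *
            (x ^ (i + 1) * s ^ (n - 2 * i)) +
          ∑ i ∈ Finset.range (n + 2), ((2 * (n + 1 - 2 * i) : ℕ) * gammaNum (n + 1) i : R) *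
            (x ^ (i + 1) * s ^ (n - 2 * i)) := by
      have e1 : D (gammaSum x s (n + 1)) = ∑ i ∈ Finset.range (n + 2),
          ((i * gammaNum (n + 1) i : R) * (x ^ i * s ^ (n + 2 - 2 * i)) +
          ((2 * (n + 1 - 2 * i) : ℕ) * gammaNum (n + 1) i : R) *
            (x ^ (i + 1) * s ^ (n - 2 * i))) := by
        rw [gammaSum, map_sum]
        refine Finset.sum_congr rfl fun i _ => ?_
        rw [D.leibniz, derivation_monomial D hx hs, D.map_natCast, smul_zero, add_zero,
          smul_eq_mul]
        -- The exponents are truncated differences; wherever truncation matters, the coefficient is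
        -- zero.
        rcases lt_or_ge (n + 1) (2 * i) with h | h
        · simp [gammaNum_eq_zero h]
        · rw [show n + 1 - 2 * i + 1 = n + 2 - 2 * i by omega,
            show n + 1 - 2 * i - 1 = n - 2 * i by omega]
          ring
      rw [e1, Finset.sum_add_distrib]
      congr 1
      rw [Finset.sum_range_succ', Finset.sum_range_succ _ (n + 1),
        gammaNum_eq_zero (show n + 1 < 2 * (n + 1 + 1) by omega)]
      simp only [Nat.cast_zero, zero_mul, mul_zero, add_zero]
      refine Finset.sum_congr rfl fun i _ => ?_
      rw [show n + 2 - 2 * (i + 1) = n - 2 * i by omega]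
    have h3 : gammaSum x s n = ∑ i ∈ Finset.range (n + 2),
        (gammaNum n i : R) * (x ^ i * s ^ (n - 2 * i)) := by
      rw [Finset.sum_range_succ, gammaNum_eq_zero (show n < 2 * (n + 1) by omega), gammaSum]
      simp
    rw [key, Nat.add_sub_cancel, h3, Finset.mul_sum, ← Finset.sum_add_distrib,
      ← Finset.sum_add_distrib, gammaSum, Finset.sum_range_succ']
    simp only [gammaNum, Nat.cast_zero, zero_mul, add_zero]
    refine Finset.sum_congr rfl fun i _ => ?_
    rw [show n + 1 + 1 - 2 * (i + 1) = n - 2 * i by omega]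
    push_cast
    ring

-- The left term at (i+1, j) and the right term at (i, j+1) both have coefficient (i+j+1) C(i+j, i).
open Finset in
theorem sum_choose_mul_cancel {f x : R} (Z : ℕ → R) : ∀ n : ℕ,
    ∑ ij ∈ antidiagonal n, (n.choose ij.1 : R) * (ij.1 * f ^ (ij.1 - 1) * x * Z ij.2) =
    ∑ ij ∈ antidiagonal n, (n.choose ij.1 : R) * (f ^ ij.1 * (ij.2 * x * Z (ij.2 - 1)))
  | 0 => by simp
  | n + 1 => by
    rw [Finset.Nat.sum_antidiagonal_succ, Finset.Nat.sum_antidiagonal_succ']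
    simp only [Nat.cast_zero, zero_mul, mul_zero, zero_add, add_tsub_cancel_right]
    refine Finset.sum_congr rfl fun ij hij => ?_
    obtain ⟨i, j⟩ := ij
    simp only [Finset.HasAntidiagonal.mem_antidiagonal] at hij
    subst hij
    have h1 : (i + j + 1).choose (i + 1) * (i + 1) = (i + j + 1) * (i + j).choose i :=
      (Nat.add_one_mul_choose_eq (i + j) i).symm
    have h2 : (i + j + 1).choose i * (j + 1) = (i + j + 1) * (i + j).choose i := by
      have := Nat.choose_mul_succ_eq (i + j) i
      rw [show i + j + 1 - i = j + 1 by omega] at this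
      linarith
    have h3 : ((i + j + 1).choose (i + 1) : R) * ((i + 1 : ℕ) : R) =
        ((i + j + 1).choose i : R) * ((j + 1 : ℕ) : R) := by
      exact_mod_cast congrArg (Nat.cast : ℕ → R) (h1.trans h2.symm)
    linear_combination (f ^ i * x * Z j) * h3

open Finset in
/-- Solving the insertion recurrence `E_{n+1} = D E_n + f E_n`. -/
theorem insertion_eq_sum {x s f : R} (hx : D x = x * s) (hs : D s = 2 * x) (hf : D f = x)
    {E : ℕ → R} (h0 : E 0 = 1) (hE : ∀ n, E (n + 1) = D (E n) + f * E n) : ∀ n : ℕ,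
    E n = ∑ ij ∈ antidiagonal n, (n.choose ij.1 : R) * (f ^ ij.1 * gammaSum x s ij.2)
  | 0 => by simp [h0, gammaSum, gammaNum]
  | n + 1 => by
    rw [Finset.sum_antidiagonal_choose_succ_mul (fun i j => f ^ i * gammaSum x s j), hE,
      insertion_eq_sum hx hs hf h0 hE n, map_sum]
    have e1 : ∑ ij ∈ antidiagonal n,
        D ((n.choose ij.1 : R) * (f ^ ij.1 * gammaSum x s ij.2)) =
        ∑ ij ∈ antidiagonal n,
          (n.choose ij.1 : R) * (ij.1 * f ^ (ij.1 - 1) * x * gammaSum x s ij.2) +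
        (∑ ij ∈ antidiagonal n, (n.choose ij.1 : R) * (f ^ ij.1 * gammaSum x s (ij.2 + 1)) -
        ∑ ij ∈ antidiagonal n,
          (n.choose ij.1 : R) * (f ^ ij.1 * (ij.2 * x * gammaSum x s (ij.2 - 1)))) := by
      rw [← Finset.sum_sub_distrib, ← Finset.sum_add_distrib]
      refine Finset.sum_congr rfl fun ij _ => ?_
      rw [gammaSum_succ D hx hs, D.leibniz, D.leibniz, D.leibniz_pow, D.map_natCast, hf]
      simp only [smul_eq_mul, nsmul_eq_mul]
      ring
    -- The terms coming from D f = x cancel the correction n x G_{n-1}; Pascal's rule remains.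
    rw [e1, sum_choose_mul_cancel]
    have e2 : ∑ ij ∈ antidiagonal n, (n.choose ij.2 : R) * (f ^ (ij.1 + 1) * gammaSum x s ij.2) =
        f * ∑ ij ∈ antidiagonal n, (n.choose ij.1 : R) * (f ^ ij.1 * gammaSum x s ij.2) := by
      rw [Finset.mul_sum]
      refine Finset.sum_congr rfl fun ij hij => ?_
      rw [Finset.HasAntidiagonal.mem_antidiagonal] at hij
      rw [Nat.choose_symm_of_eq_add (by omega : n = ij.2 + ij.1)]
      ring
    rw [e2]
    ring

open Finset in
/-- The homogeneous form of the recurrence of the Eulerian polynomials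
`A_n = x ∑ C(n, m) A_m (1 - x)^(n - m) + (1 - x)^(n + 1)`. -/
theorem eulerian_insertion {a b : R} (ha : D a = a * b) (hb : D b = a * b)
    {E : ℕ → R} (h0 : E 0 = 1) (hE : ∀ n, E (n + 1) = D (E n) + b * E n) : ∀ n : ℕ,
    b * E n = ∑ ij ∈ antidiagonal n, (n.choose ij.1 : R) * (a * (b - a) ^ ij.1 * E ij.2) +
      (b - a) ^ (n + 1)
  | 0 => by simp [h0]
  | n + 1 => by
    have IH := eulerian_insertion ha hb h0 hE n
    -- As b - a is a constant of D and D(a E_j) = a E_{j+1}, the next identity is D applied to the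
    -- present one plus (b - a) times it.
    have hD : D (b - a) = 0 := by rw [map_sub, ha, hb, sub_self]
    have hDp : ∀ k : ℕ, D ((b - a) ^ k) = 0 := fun k => by simp [D.leibniz_pow, hD]
    have h1 := congrArg D IH
    rw [D.leibniz, map_add, hDp, map_sum, hb] at h1
    have e1 : ∑ ij ∈ antidiagonal n, D ((n.choose ij.1 : R) * (a * (b - a) ^ ij.1 * E ij.2)) =
        ∑ ij ∈ antidiagonal n, (n.choose ij.1 : R) * (a * (b - a) ^ ij.1 * E (ij.2 + 1)) := by
      refine Finset.sum_congr rfl fun ij _ => ?_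
      rw [D.leibniz, D.leibniz, D.leibniz, D.map_natCast, hDp, ha, hE]
      simp only [smul_eq_mul]
      ring
    rw [Finset.sum_antidiagonal_choose_succ_mul (fun i j => a * (b - a) ^ i * E j), hE]
    have e2 : ∑ ij ∈ antidiagonal n, (n.choose ij.2 : R) * (a * (b - a) ^ (ij.1 + 1) * E ij.2) =
        (b - a) * ∑ ij ∈ antidiagonal n, (n.choose ij.1 : R) * (a * (b - a) ^ ij.1 * E ij.2) := by
      rw [Finset.mul_sum]
      refine Finset.sum_congr rfl fun ij hij => ?_
      rw [Finset.HasAntidiagonal.mem_antidiagonal] at hij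
      rw [Nat.choose_symm_of_eq_add (by omega : n = ij.2 + ij.1)]
      ring
    rw [e1] at h1
    rw [e2]
    simp only [smul_eq_mul] at h1
    linear_combination h1 + (b - a) * IH

end Derivation

/-! ### Insertion of a minimal letter into a cycle -/

/-- The weight of the letter `c` of a permutation sending `p` to `c` and `c` to `q`: cyclic
valleys, double excedances, double anti-excedances and fixed points are marked by `x`, `a`, `b`
and `f`. -/
def cycWeight {R α : Type*} [CommRing R] [LinearOrder α] (x a b f : R) (p c q : α) : R :=
  if c < q then (if p < c then a else x) else if q < c then (if c < p then b else 1) else f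

/-- The product of the weights of the letters of a permutation. -/
def permWeight {R : Type*} [CommRing R] {n : ℕ} (x a b f : R) (w : Equiv.Perm (Fin n)) : R :=
  ∏ i, cycWeight x a b f (w.symm i) i (w i)

theorem derivation_prod {K R ι : Type*} [CommRing K] [CommRing R] [Algebra K R] [DecidableEq ι]
    (D : Derivation K R R)
    (s : Finset ι) (g : ι → R) : D (∏ i ∈ s, g i) = ∑ i ∈ s, D (g i) * ∏ j ∈ s.erase i, g j := by
  induction s using Finset.induction_on with
  | empty => simp
  | insert k s hk ih =>
    rw [Finset.prod_insert hk, D.leibniz, ih, Finset.sum_insert hk, Finset.erase_insert hk,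
      smul_eq_mul, smul_eq_mul, Finset.mul_sum, add_comm, mul_comm]
    congr 1
    refine Finset.sum_congr rfl fun i hi => ?_
    have hki : k ≠ i := fun h => hk (h ▸ hi)
    rw [Finset.erase_insert_of_ne hki, Finset.prod_insert (fun h => hk (Finset.mem_of_mem_erase h))]
    ring

section

variable {R : Type*} [CommRing R] {n : ℕ} (x a b f : R)

/-- `decomposeFin.symm (j.succ, e)` shifts the letters of `e` up and puts the new smallest letter 0
on the arc from `e.symm j` to `j`. -/
theorem insert_symm_succ (e : Equiv.Perm (Fin n)) (j i : Fin n) :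
    (Equiv.Perm.decomposeFin.symm (j.succ, e)).symm i.succ =
      if i = j then 0 else (e.symm i).succ := by
  rw [Equiv.symm_apply_eq]
  split_ifs with h
  · rw [Equiv.Perm.decomposeFin_symm_apply_zero, h]
  · rw [Equiv.Perm.decomposeFin_symm_apply_succ, Equiv.apply_symm_apply,
      Equiv.swap_apply_of_ne_of_ne (Fin.succ_ne_zero _) (fun h' => h (Fin.succ_injective _ h'))]

theorem insert_succ (e : Equiv.Perm (Fin n)) (j i : Fin n) :
    Equiv.Perm.decomposeFin.symm (j.succ, e) i.succ =
      if i = e.symm j then 0 else (e i).succ := by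
  rw [Equiv.Perm.decomposeFin_symm_apply_succ]
  split_ifs with h
  · rw [h, Equiv.apply_symm_apply, Equiv.swap_apply_right]
  · rw [Equiv.swap_apply_of_ne_of_ne (Fin.succ_ne_zero _)]
    intro h'
    exact h ((Equiv.eq_symm_apply e).2 (Fin.succ_injective _ h'))

theorem insert_symm_zero (e : Equiv.Perm (Fin n)) (j : Fin n) :
    (Equiv.Perm.decomposeFin.symm (j.succ, e)).symm 0 = (e.symm j).succ := by
  rw [Equiv.symm_apply_eq, insert_succ, if_pos rfl]

theorem permWeight_insert_fixed (e : Equiv.Perm (Fin n)) :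
    permWeight x a b f (Equiv.Perm.decomposeFin.symm (0, e)) = f * permWeight x a b f e := by
  have h : ∀ i : Fin n, (Equiv.Perm.decomposeFin.symm (0, e)).symm i.succ = (e.symm i).succ := by
    intro i
    rw [Equiv.symm_apply_eq]
    simp
  rw [permWeight, Fin.prod_univ_succ, permWeight]
  refine congrArg₂ (· * ·) ?_ ?_
  · simp [cycWeight]
  · refine Finset.prod_congr rfl fun i _ => ?_
    rw [h]
    simp [cycWeight, Fin.succ_lt_succ_iff]

/-- The new letter is a valley. Only the smaller end of the subdivided arc changes type: the source
of an ascending arc, the target of a descending one. A loop turns its fixed point into a peak. -/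
theorem permWeight_insert (e : Equiv.Perm (Fin n)) (j : Fin n) :
    permWeight x a b f (Equiv.Perm.decomposeFin.symm (j.succ, e)) =
      x * ((if e.symm j < j then (if e.symm (e.symm j) < e.symm j then 1 else b) *
          ∏ k ∈ Finset.univ.erase (e.symm j), cycWeight x a b f (e.symm k) k (e k) else 0) +
        (if j < e.symm j then (if j < e j then a else 1) else if e.symm j = j then 1 else 0) *
          ∏ k ∈ Finset.univ.erase j, cycWeight x a b f (e.symm k) k (e k)) := by
  set t : Fin n → R := fun k => cycWeight x a b f (e.symm k) k (e k) with ht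
  set t' : Fin n → R := fun i => cycWeight x a b f
    (if i = j then 0 else (e.symm i).succ) i.succ (if i = e.symm j then 0 else (e i).succ) with ht'
  have hw : permWeight x a b f (Equiv.Perm.decomposeFin.symm (j.succ, e)) = x * ∏ i, t' i := by
    rw [permWeight, Fin.prod_univ_succ, insert_symm_zero, Equiv.Perm.decomposeFin_symm_apply_zero]
    refine congrArg₂ (· * ·) ?_ ?_
    · simp [cycWeight]
    · exact Finset.prod_congr rfl fun i _ => by rw [insert_symm_succ, insert_succ]
  have hgen : ∀ i, i ≠ j → i ≠ e.symm j → t' i = t i := by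
    intro i h1 h2
    simp [ht, ht', h1, h2, cycWeight]
  have hprod : ∀ c, (∀ i, i ≠ c → t' i = t i) →
      ∏ i, t' i = t' c * ∏ k ∈ Finset.univ.erase c, t k := by
    intro c hc
    rw [← Finset.mul_prod_erase _ _ (Finset.mem_univ c)]
    congr 1
    exact Finset.prod_congr rfl fun i hi => hc i (Finset.ne_of_mem_erase hi)
  rw [hw]
  congr 1
  obtain ⟨c, rfl⟩ : ∃ c, j = e c := ⟨e.symm j, by simp⟩
  simp only [Equiv.symm_apply_apply] at *
  rcases lt_trichotomy c (e c) with h | h | h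
  · rw [if_pos h, if_neg h.not_gt, if_neg h.ne, zero_mul, add_zero, hprod c]
    · congr 1
      rcases lt_trichotomy (e.symm c) c with h2 | h2 | h2
      · simp [ht', cycWeight, h.ne, h2, h2.not_gt]
      · rw [Equiv.symm_apply_eq] at h2
        exact absurd h2 h.ne
      · simp [ht', cycWeight, h.ne, h2, h2.not_gt]
    · intro i hi
      by_cases hij : i = e c
      · subst hij
        simp [ht, ht', cycWeight, h.ne', h, h.not_gt]
      · exact hgen i hij hi
  · have hc : t' (e c) = 1 := by simp [ht', cycWeight, ← h]
    rw [if_neg (by rw [← h]; exact lt_irrefl _), if_neg (by rw [← h]; exact lt_irrefl _),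
      if_pos h, zero_add, hprod (e c), hc]
    intro i hi
    exact hgen i hi (by rwa [h])
  · rw [if_neg h.not_gt, if_pos h, zero_add, hprod (e c)]
    · congr 1
      rcases lt_trichotomy (e (e c)) (e c) with h2 | h2 | h2
      · simp [ht', cycWeight, h.ne, h2]
      · exact absurd (e.injective h2) h.ne
      · simp [ht', cycWeight, h.ne, h2]
    · intro i hi
      by_cases hij : i = c
      · subst hij
        simp [ht, ht', cycWeight, h.ne', h, h.not_gt]
      · exact hgen i hi hij

variable {x a b f} {K : Type*} [CommRing K] [Algebra K R] (D : Derivation K R R)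

/-- The two summands are the insertions on the outgoing and the incoming arc of `i` that change `i`.
A valley admits both, a peak neither, and a loop is counted once. -/
theorem derivation_cycWeight (hx : D x = x * (a + b)) (ha : D a = x) (hb : D b = x)
    (hf : D f = x) (e : Equiv.Perm (Fin n)) (i : Fin n) :
    D (cycWeight x a b f (e.symm i) i (e i)) =
      x * ((if i < e i then (if e.symm i < i then 1 else b) else 0) +
        (if i < e.symm i then (if i < e i then a else 1) else if e.symm i = i then 1 else 0)) := by
  have key : e.symm i = i ↔ e i = i := by rw [Equiv.symm_apply_eq, eq_comm]
  rcases lt_trichotomy (e i) i with h | h | h <;>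
    rcases lt_trichotomy (e.symm i) i with h2 | h2 | h2 <;>
    first
    | exact absurd (key.1 h2) h.ne
    | exact absurd (key.1 h2) h.ne'
    | exact absurd (key.2 h) h2.ne
    | exact absurd (key.2 h) h2.ne'
    | skip
  · simp [cycWeight, h, h.not_gt, h2.not_gt, h2.ne]
  · simp [cycWeight, h, h2, h.not_gt, hb]
  · simp [cycWeight, h, h2, hf]
  · simp [cycWeight, h, h2, h2.not_gt, h2.ne, ha]
  · simp [cycWeight, h, h2, h2.not_gt, hx, add_comm]

theorem sum_permWeight_succ (hx : D x = x * (a + b)) (ha : D a = x) (hb : D b = x)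
    (hf : D f = x) (n : ℕ) :
    ∑ w : Equiv.Perm (Fin (n + 1)), permWeight x a b f w =
      D (∑ w : Equiv.Perm (Fin n), permWeight x a b f w) +
        f * ∑ w : Equiv.Perm (Fin n), permWeight x a b f w := by
  rw [← Equiv.sum_comp Equiv.Perm.decomposeFin.symm, Fintype.sum_prod_type_right, map_sum,
    Finset.mul_sum, ← Finset.sum_add_distrib]
  refine Finset.sum_congr rfl fun e _ => ?_
  rw [Fin.sum_univ_succ, permWeight_insert_fixed, add_comm]
  congr 1
  simp only [permWeight_insert]
  -- Each insertion is charged to the letter it changes, so the sum over ascending arcs is reindexed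
  -- by their sources.
  rw [← Finset.mul_sum, Finset.sum_add_distrib, ← Equiv.sum_comp e]
  simp only [Equiv.symm_apply_apply]
  rw [permWeight, derivation_prod, ← Finset.sum_add_distrib, Finset.mul_sum]
  refine Finset.sum_congr rfl fun i _ => ?_
  rw [derivation_cycWeight D hx ha hb hf]
  split_ifs <;> ring

end

/-! ### Insertion of a minimal letter into a word -/

open Classical in
/-- The weight of a letter of a word, where `P` says that the previous letter is smaller, `Q` that
the next letter is larger, and `M` that the letter is a left to right maximum. -/
noncomputable def letterWeight {R : Type*} [CommRing R] (x a b f : R) (P Q M : Prop) : R :=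
  if Q then (if P then (if M then f else a) else x) else (if P then 1 else b)

/-- The first letter of a word, and `⊤` for the empty word. -/
def headOrTop {α : Type*} : List α → WithTop α
  | [] => ⊤
  | c :: _ => c

/-- The product of the weights of the letters of a word which is preceded by the letter `p`, where
`m` is the largest of the preceding letters, and which is followed by an infinite letter. -/
noncomputable def wordWeight {R α : Type*} [CommRing R] [LinearOrder α] (x a b f : R) :
    WithBot α → WithBot α → List α → R
  | _, _, [] => 1
  | p, m, c :: l => letterWeight x a b f (p < c) ((c : WithTop α) < headOrTop l) (m < c) *
      wordWeight x a b f c (max m c) l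

section

variable {R α : Type*} [CommRing R] [LinearOrder α] {x a b f : R}
  {K : Type*} [CommRing K] [Algebra K R] (D : Derivation K R R)

theorem wordWeight_congr {p p' m m' : WithBot α} {c : α} (hp : p < c ↔ p' < c)
    (hm : max m c = max m' c) (hm' : m < c ↔ m' < c) (l : List α) :
    wordWeight x a b f p m (c :: l) = wordWeight x a b f p' m' (c :: l) := by
  simp only [wordWeight, hp, hm, hm']

/-- The gap directly before `c` is charged to `c` only if the preceding letter is larger; this is
the extra term, where `k` has become the predecessor. Every other gap counted here lies after `c`.
By `p ≤ m`, a letter below its predecessor is not a left-to-right maximum. -/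
theorem sum_wordWeight_insert_after (hx : D x = x * (a + b)) (ha : D a = x) (hb : D b = x)
    (hf : D f = x) {k : α} : ∀ (l : List α) (p m : WithBot α) (c : α), p ≤ m → k < c →
    (∀ y ∈ l, k < y) →
    ((l.permutations'Aux k).map fun l' => wordWeight x a b f p m (c :: l')).sum +
      (if p < c then 0 else x * wordWeight x a b f k m (c :: l)) =
      D (wordWeight x a b f p m (c :: l))
  | [], p, m, c, hpm, hkc, _ => by
    have hkc' : (k : WithBot α) < c := WithBot.coe_lt_coe.2 hkc
    have h2 : ¬ (c : WithTop α) < k := fun h => (WithTop.coe_lt_coe.1 h).not_gt hkc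
    have h3 : ¬ ((c : WithBot α) < k) := hkc'.not_gt
    by_cases hp : p < c
    · by_cases hm : m < c <;>
      simp [wordWeight, letterWeight, headOrTop, h2, hp, h3, hm, ha, hf]
    · have hm : ¬ m < c := fun h => hp (hpm.trans_lt h)
      simp [wordWeight, letterWeight, headOrTop, h2, hp, h3, hm, hkc', hx]
      ring
  | d :: l, p, m, c, hpm, hkc, hl => by
    have hkc' : (k : WithBot α) < c := WithBot.coe_lt_coe.2 hkc
    have hkd' : (k : WithBot α) < d := WithBot.coe_lt_coe.2 (hl d (by simp))
    have h2 : ¬ (c : WithTop α) < k := fun h => (WithTop.coe_lt_coe.1 h).not_gt hkc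
    have h3 : ¬ ((c : WithBot α) < k) := hkc'.not_gt
    have h4 : (k : WithTop α) < d := WithTop.coe_lt_coe.2 (hl d (by simp))
    have h5 : max (max m c) (k : WithBot α) = max m c :=
      max_eq_left (hkc'.le.trans (le_max_right _ _))
    have IH := sum_wordWeight_insert_after hx ha hb hf l c (max m c) d (le_max_right _ _)
      (hl d (by simp)) (fun y hy => hl y (by simp [hy]))
    have e1 : ∀ l' : List α, wordWeight x a b f p m (c :: d :: l') =
        letterWeight x a b f (p < c) ((c : WithTop α) < d) (m < c) *
          wordWeight x a b f c (max m c) (d :: l') := fun l' => by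
      rw [wordWeight, headOrTop]
    have e2 : wordWeight x a b f p m (c :: k :: d :: l) =
        letterWeight x a b f (p < c) False (m < c) * (x *
          wordWeight x a b f k (max m c) (d :: l)) := by
      rw [wordWeight, headOrTop, wordWeight, headOrTop, h5]
      simp [h2, h3, h4, letterWeight]
    have e3 : wordWeight x a b f k m (c :: d :: l) =
        letterWeight x a b f True ((c : WithTop α) < d) (m < c) *
          wordWeight x a b f c (max m c) (d :: l) := by
      rw [wordWeight, headOrTop]
      simp [hkc']
    rw [List.permutations'Aux, List.map_cons, List.sum_cons, List.map_map]
    simp only [Function.comp_def, e1, e2, e3]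
    rw [List.sum_map_mul_left, D.leibniz, ← IH, smul_eq_mul, smul_eq_mul]
    generalize ((l.permutations'Aux k).map fun l' =>
      wordWeight x a b f c (max m c) (d :: l')).sum = S
    by_cases hcd : c < d
    · have h6 : (c : WithTop α) < d := WithTop.coe_lt_coe.2 hcd
      have h7 : (c : WithBot α) < d := WithBot.coe_lt_coe.2 hcd
      -- For c < d the inserted `k` does not affect `d`, so the gap between them is charged to `c`.
      rw [wordWeight_congr (p := (k : WithBot α)) (p' := (c : WithBot α))
        (m := max m c) (m' := max m c) (by simp [hkd', h7]) rfl Iff.rfl]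
      by_cases hp : p < c
      · by_cases hm : m < c <;> simp [letterWeight, h6, h7, hp, hm, ha, hf] <;> ring
      · have hm : ¬ m < c := fun h => hp (hpm.trans_lt h)
        simp [letterWeight, h6, h7, hp, hm, hx]
        ring
    · have h6 : ¬ (c : WithTop α) < d := fun h => hcd (WithTop.coe_lt_coe.1 h)
      have h7 : ¬ (c : WithBot α) < d := fun h => hcd (WithBot.coe_lt_coe.1 h)
      by_cases hp : p < c
      · simp [letterWeight, h6, h7, hp]
        ring
      · simp [letterWeight, h6, h7, hp, hb]
        ring

theorem sum_wordWeight_insert (hx : D x = x * (a + b)) (ha : D a = x) (hb : D b = x)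
    (hf : D f = x) {k : α} : ∀ l : List α, (∀ y ∈ l, k < y) →
    ((l.permutations'Aux k).map (wordWeight x a b f ⊥ ⊥)).sum =
      D (wordWeight x a b f ⊥ ⊥ l) + f * wordWeight x a b f ⊥ ⊥ l
  | [], _ => by simp [wordWeight, letterWeight, headOrTop]
  | c :: l, hl => by
    have hkc : k < c := hl c (by simp)
    have hkc' : (k : WithBot α) < c := WithBot.coe_lt_coe.2 hkc
    have h := sum_wordWeight_insert_after D hx ha hb hf l ⊥ ⊥ c le_rfl hkc
      (fun y hy => hl y (by simp [hy]))
    rw [if_pos (WithBot.bot_lt_coe c), add_zero] at h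
    rw [List.permutations'Aux, List.map_cons, List.sum_cons, List.map_map, ← h, add_comm]
    congr 1
    -- In front, `k` is a left-to-right maximum followed by a larger letter, with weight `f`; the
    -- old first letter keeps its type.
    rw [wordWeight, headOrTop, wordWeight_congr (p' := ⊥) (m' := ⊥)]
    · simp [letterWeight, hkc]
    · simp [hkc]
    · simp [hkc.le]
    · simp [hkc]

/-- Both sides obey the same insertion recurrence; in an increasing list the head is the smallest
letter. -/
theorem sum_wordWeight_permutations (hx : D x = x * (a + b)) (ha : D a = x) (hb : D b = x)
    (hf : D f = x) : ∀ l : List α, l.Pairwise (· < ·) →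
    (l.permutations'.map (wordWeight x a b f ⊥ ⊥)).sum =
      ∑ w : Equiv.Perm (Fin l.length), permWeight x a b f w
  | [], _ => by simp [wordWeight, permWeight]
  | k :: l, hl => by
    rw [List.pairwise_cons] at hl
    rw [List.length_cons, sum_permWeight_succ D hx ha hb hf,
      ← sum_wordWeight_permutations hx ha hb hf l hl.2, List.permutations', List.map_flatMap,
      List.flatMap_def, List.sum_flatten, List.map_map, map_list_sum, List.map_map, ← List.sum_map_mul_left, ← List.sum_map_add]
    congr 1
    refine List.map_congr_left fun l' hl' => ?_
    exact sum_wordWeight_insert D hx ha hb hf l'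
      fun y hy => hl.1 y ((List.mem_permutations'.1 hl').mem_iff.1 hy)

end

theorem sum_permutations'_finRange {R : Type*} [AddCommMonoid R] (n : ℕ) (g : List (Fin n) → R) :
    ((List.finRange n).permutations'.map g).sum = ∑ w : Equiv.Perm (Fin n), g (List.ofFn w) := by
  classical
  have hinj : Function.Injective fun w : Equiv.Perm (Fin n) => List.ofFn w := fun w w' h =>
    DFunLike.coe_injective (List.ofFn_injective h)
  have hnd : (List.finRange n).permutations'.Nodup :=
    (List.permutations_perm_permutations' _).nodup_iff.1
      (List.nodup_permutations _ (List.nodup_finRange n))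
  rw [← List.sum_toFinset _ hnd, ← Finset.sum_image (g := fun w : Equiv.Perm (Fin n) => List.ofFn w)
    (f := g) (fun w _ w' _ h => hinj h)]
  congr 1
  symm
  -- One inclusion suffices, as both sets have n! elements.
  apply Finset.eq_of_subset_of_card_le
  · intro l hl
    obtain ⟨w, -, rfl⟩ := Finset.mem_image.1 hl
    rw [List.mem_toFinset, List.mem_permutations']
    simpa [List.ofFn_id] using Equiv.Perm.ofFn_comp_perm w (id : Fin n → Fin n)
  · rw [List.toFinset_card_of_nodup hnd, Finset.card_image_of_injective _ hinj, Finset.card_univ,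
      Fintype.card_perm, ← (List.permutations_perm_permutations' _).length_eq,
      List.length_permutations, List.length_finRange, Fintype.card_fin]

theorem wordWeight_ofFn {R α : Type*} [CommRing R] [LinearOrder α] {x a b f : R} :
    ∀ {n : ℕ} (w : Fin n → α) (p m : WithBot α), wordWeight x a b f p m (List.ofFn w) =
      ∏ i : Fin n, letterWeight x a b f ((∀ j : Fin n, (j : ℕ) + 1 = i → w j < w i) ∧
          ((i : ℕ) = 0 → p < w i))
        (∀ k : Fin n, (i : ℕ) + 1 = k → w i < w k) ((∀ j < i, w j < w i) ∧ m < w i)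
  | 0, w, p, m => by simp [wordWeight]
  | n + 1, w, p, m => by
    rw [List.ofFn_succ, wordWeight, wordWeight_ofFn, Fin.prod_univ_succ]
    congr 1
    · congr 1
      · simp
      · rcases n with _ | n
        · simp [headOrTop]
        · simp only [List.ofFn_succ, headOrTop, eq_iff_iff, WithTop.coe_lt_coe]
          constructor
          · intro h k hk
            have : k = Fin.succ 0 := Fin.ext (by simpa using hk.symm)
            rwa [this]
          · intro h
            exact h _ (by simp)
      · simp
    · refine Finset.prod_congr rfl fun i _ => ?_
      congr 1
      · simp [Fin.forall_fin_succ, and_comm, eq_comm]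
      · simp [Fin.forall_fin_succ]
      · simp [Fin.forall_fin_succ, and_comm, and_left_comm, and_assoc]

/-! ### Specialization to arbitrary commutative rings -/

theorem map_gammaSum {R S : Type*} [CommRing R] [CommRing S] (φ : R →+* S) (x s : R) (n : ℕ) :
    φ (gammaSum x s n) = gammaSum (φ x) (φ s) n := by
  simp [gammaSum]

theorem map_permWeight {R S : Type*} [CommRing R] [CommRing S] (φ : R →+* S) (x a b f : R)
    {n : ℕ} (w : Equiv.Perm (Fin n)) :
    φ (permWeight x a b f w) = permWeight (φ x) (φ a) (φ b) (φ f) w := by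
  simp only [permWeight, map_prod]
  refine Finset.prod_congr rfl fun i _ => ?_
  simp only [cycWeight, apply_ite φ, map_one]

theorem map_wordWeight {R S α : Type*} [CommRing R] [CommRing S] [LinearOrder α] (φ : R →+* S)
    (x a b f : R) : ∀ (l : List α) (p m : WithBot α),
    φ (wordWeight x a b f p m l) = wordWeight (φ x) (φ a) (φ b) (φ f) p m l
  | [], p, m => by simp [wordWeight]
  | c :: l, p, m => by
    rw [wordWeight, map_mul, map_wordWeight φ x a b f l, wordWeight]
    congr 1
    unfold letterWeight
    split_ifs <;> simp

/-- The derivation of `ℤ[x, a, b, f]` with `x ↦ x (a + b)` and `a, b, f ↦ x`. -/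
noncomputable def insertionDerivation :
    Derivation ℤ (MvPolynomial (Fin 4) ℤ) (MvPolynomial (Fin 4) ℤ) :=
  MvPolynomial.mkDerivation ℤ
    ![MvPolynomial.X 0 * (MvPolynomial.X 1 + MvPolynomial.X 2), MvPolynomial.X 0,
      MvPolynomial.X 0, MvPolynomial.X 0]

section

/-- The identity is proved for free variables, since no derivation has the required values after a
specialization such as b = 1 or f = 0. -/
theorem sum_permWeight_generic (n : ℕ) :
    ∑ w : Equiv.Perm (Fin n), permWeight (MvPolynomial.X 0 : MvPolynomial (Fin 4) ℤ)
      (MvPolynomial.X 1) (MvPolynomial.X 2) (MvPolynomial.X 3) w =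
    ∑ ij ∈ Finset.HasAntidiagonal.antidiagonal n, (n.choose ij.1 : MvPolynomial (Fin 4) ℤ) *
      (MvPolynomial.X 3 ^ ij.1 *
        gammaSum (MvPolynomial.X 0) (MvPolynomial.X 1 + MvPolynomial.X 2) ij.2) := by
  refine insertion_eq_sum insertionDerivation (E := fun n => ∑ w : Equiv.Perm (Fin n),
    permWeight (MvPolynomial.X 0 : MvPolynomial (Fin 4) ℤ)
      (MvPolynomial.X 1) (MvPolynomial.X 2) (MvPolynomial.X 3) w) ?_ ?_ ?_ ?_ ?_ n
  · simp [insertionDerivation, MvPolynomial.mkDerivation_X]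
  · simp [insertionDerivation, MvPolynomial.mkDerivation_X, two_mul]
  · simp [insertionDerivation, MvPolynomial.mkDerivation_X]
  · simp [permWeight]
  · exact sum_permWeight_succ insertionDerivation
      (by simp [insertionDerivation, MvPolynomial.mkDerivation_X])
      (by simp [insertionDerivation, MvPolynomial.mkDerivation_X])
      (by simp [insertionDerivation, MvPolynomial.mkDerivation_X])
      (by simp [insertionDerivation, MvPolynomial.mkDerivation_X])

theorem sum_wordWeight_generic (n : ℕ) :
    ∑ w : Equiv.Perm (Fin n), wordWeight (MvPolynomial.X 0 : MvPolynomial (Fin 4) ℤ)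
      (MvPolynomial.X 1) (MvPolynomial.X 2) (MvPolynomial.X 3) ⊥ ⊥ (List.ofFn w) =
    ∑ w : Equiv.Perm (Fin n), permWeight (MvPolynomial.X 0 : MvPolynomial (Fin 4) ℤ)
      (MvPolynomial.X 1) (MvPolynomial.X 2) (MvPolynomial.X 3) w := by
  rw [← sum_permutations'_finRange n (wordWeight (MvPolynomial.X 0 : MvPolynomial (Fin 4) ℤ)
      (MvPolynomial.X 1) (MvPolynomial.X 2) (MvPolynomial.X 3) ⊥ ⊥),
    sum_wordWeight_permutations insertionDerivation _ _ _ _ _ (List.pairwise_lt_finRange n),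
    List.length_finRange]
  all_goals simp [insertionDerivation, MvPolynomial.mkDerivation_X]

variable {R : Type*} [CommRing R]

/-- Derangements, by cyclic valleys, double excedances and double anti-excedances. -/
theorem sum_permWeight_derangements (x a b : R) (n : ℕ) :
    ∑ w : Equiv.Perm (Fin n), permWeight x a b 0 w = gammaSum x (a + b) n := by
  have h := congrArg (MvPolynomial.aeval (R := ℤ) ![x, a, b, 0]).toRingHom (sum_permWeight_generic n)
  simp only [map_sum, map_mul, map_pow, map_gammaSum, map_permWeight, map_natCast, map_add] at h
  simp only [AlgHom.toRingHom_eq_coe, RingHom.coe_coe, MvPolynomial.aeval_X] at h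
  refine h.trans ?_
  -- At f = 0 only the summand with f^0 survives.
  rw [Finset.sum_eq_single (0, n)]
  · simp
  · rintro ⟨i, j⟩ hij hne
    rw [Finset.HasAntidiagonal.mem_antidiagonal] at hij
    have : i ≠ 0 := by
      rintro rfl
      exact hne (by simp_all)
    simp [this]
  · simp

theorem sum_wordWeight (x a b : R) (n : ℕ) :
    ∑ w : Equiv.Perm (Fin n), wordWeight x a b 0 ⊥ ⊥ (List.ofFn w) = gammaSum x (a + b) n := by
  have h := congrArg (MvPolynomial.aeval (R := ℤ) ![x, a, b, 0]).toRingHom (sum_wordWeight_generic n)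
  simp only [map_sum, map_permWeight, map_wordWeight] at h
  simp only [AlgHom.toRingHom_eq_coe, RingHom.coe_coe, MvPolynomial.aeval_X] at h
  exact h.trans (sum_permWeight_derangements x a b n)

/-- The recurrence of the Eulerian polynomials, for their expansion in the polynomials
`∑ ξ_{n,i} x^i (1 + x)^(n - 2i)`. -/
theorem eulerian_recurrence {A : ℕ → ℤ[X]} (hA : ∀ n, A n = ∑ ij ∈ Finset.HasAntidiagonal.antidiagonal n,
    (n.choose ij.1 : ℤ[X]) * gammaSum X (1 + X) ij.2) (n : ℕ) :
    A n = ∑ ij ∈ Finset.HasAntidiagonal.antidiagonal n, (n.choose ij.1 : ℤ[X]) * (X * (1 - X) ^ ij.1 * A ij.2) +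
      (1 - X) ^ (n + 1) := by
  -- With D a = D b = ab, the choice x = ab, s = a + b, f = b meets the hypotheses of
  -- `insertion_eq_sum`; at a = X, b = 1 the solution becomes `A`.
  let D : Derivation ℤ (MvPolynomial (Fin 2) ℤ) (MvPolynomial (Fin 2) ℤ) :=
    MvPolynomial.mkDerivation ℤ fun _ => MvPolynomial.X 0 * MvPolynomial.X 1
  let E : ℕ → MvPolynomial (Fin 2) ℤ := fun n =>
    Nat.rec 1 (fun _ e => D e + MvPolynomial.X 1 * e) n
  have hD : ∀ i, D (MvPolynomial.X i) = MvPolynomial.X 0 * MvPolynomial.X 1 := fun i =>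
    MvPolynomial.mkDerivation_X _ _ _
  have h1 := insertion_eq_sum D (x := MvPolynomial.X 0 * MvPolynomial.X 1)
    (s := MvPolynomial.X 0 + MvPolynomial.X 1) (f := MvPolynomial.X 1)
    (by rw [D.leibniz, hD, hD, smul_eq_mul, smul_eq_mul]; ring) (by rw [map_add, hD, hD]; ring)
    (hD 1) (E := E) rfl (fun _ => rfl)
  have h2 := eulerian_insertion D (hD 0) (hD 1) (E := E) rfl (fun _ => rfl) n
  have h3 : ∀ m, (MvPolynomial.aeval (R := ℤ) ![(X : ℤ[X]), 1]).toRingHom (E m) = A m := by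
    intro m
    rw [h1, hA]
    simp only [map_sum, map_mul, map_pow, map_gammaSum, map_natCast, map_add]
    simp [add_comm]
  have h := congrArg (MvPolynomial.aeval (R := ℤ) ![(X : ℤ[X]), 1]).toRingHom h2
  simp only [map_sum, map_mul, map_pow, map_natCast, map_add, map_sub, h3] at h
  simpa using h

end

/-! ### The barycentric subdivision of the simplex -/

theorem sum_antidiagonal_choose_eq_sum_powerset {R V : Type*} [CommRing R] (F : Finset V)
    (g : ℕ → ℕ → R) : ∑ ij ∈ Finset.HasAntidiagonal.antidiagonal F.card, (F.card.choose ij.1 : R) * g ij.1 ij.2 =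
      ∑ G ∈ F.powerset, g (F.card - G.card) G.card := by
  rw [Finset.sum_powerset_apply_card (fun m => g (F.card - m) m),
    ← Finset.Nat.sum_antidiagonal_eq_sum_range_succ_mk
      (fun ij : ℕ × ℕ => F.card.choose ij.1 • g (F.card - ij.1) ij.1),
    ← Finset.Nat.sum_antidiagonal_swap]
  refine Finset.sum_congr rfl fun ij hij => ?_
  rw [Finset.HasAntidiagonal.mem_antidiagonal] at hij
  rw [Prod.fst_swap, nsmul_eq_mul, Nat.choose_symm_of_eq_add hij.symm,
    Prod.snd_swap,
    show F.card - ij.1 = ij.2 by omega]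

section Barycentric

variable {V : Type*} [DecidableEq V]

theorem subset_chainCarrier {E : Finset (Finset V)} {A : Finset V} (hA : A ∈ E) :
    A ⊆ chainCarrier E :=
  Finset.le_sup (f := id) hA

theorem chainCarrier_subset_iff {E : Finset (Finset V)} {F : Finset V} :
    chainCarrier E ⊆ F ↔ ∀ A ∈ E, A ⊆ F :=
  Finset.sup_le_iff

theorem chainCarrier_insert {E : Finset (Finset V)} {G : Finset V} (h : chainCarrier E ⊆ G) :
    chainCarrier (insert G E) = G := by
  rw [chainCarrier, Finset.sup_insert]
  exact sup_eq_left.2 h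

variable [Fintype V]

theorem mem_barycentric_simplex {E : Finset (Finset V)} : E ∈ (simplex V).barycentric.faces ↔
    ∅ ∉ E ∧ ∀ A ∈ E, ∀ B ∈ E, A ⊆ B ∨ B ⊆ A := by
  simp [FinComplex.barycentric, simplex]

theorem chainCarrier_mem {E : Finset (Finset V)} (hE : E ∈ (simplex V).barycentric.faces)
    (h : E.Nonempty) : chainCarrier E ∈ E := by
  obtain ⟨M, hM, hmax⟩ := E.exists_max_image Finset.card h
  have : chainCarrier E = M := by
    refine (chainCarrier_subset_iff.2 fun A hA => ?_).antisymm (subset_chainCarrier hM)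
    rcases (mem_barycentric_simplex.1 hE).2 A hA M hM with h1 | h1
    · exact h1
    · exact (Finset.eq_of_subset_of_card_le h1 (hmax A hA)).ge
  rwa [this]

/-- Cardinality is injective on a chain, with values between 1 and the size of the carrier. -/
theorem card_le_card_chainCarrier {E : Finset (Finset V)}
    (hE : E ∈ (simplex V).barycentric.faces) : E.card ≤ (chainCarrier E).card := by
  rw [mem_barycentric_simplex] at hE
  have : E.card ≤ (Finset.Icc 1 (chainCarrier E).card).card := by
    refine Finset.card_le_card_of_injOn Finset.card (fun A hA => ?_) fun A hA B hB hAB => ?_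
    · refine Finset.mem_coe.2 (Finset.mem_Icc.2 ⟨?_, Finset.card_le_card (subset_chainCarrier hA)⟩)
      rw [Nat.one_le_iff_ne_zero, Ne, Finset.card_eq_zero]
      rintro rfl
      exact hE.1 hA
    · rcases hE.2 A hA B hB with h | h
      · exact Finset.eq_of_subset_of_card_le h hAB.ge
      · exact (Finset.eq_of_subset_of_card_le h hAB.le).symm
  simpa using this

theorem insert_mem_barycentric {E : Finset (Finset V)} {G : Finset V}
    (hE : E ∈ (simplex V).barycentric.faces) (hG : G ≠ ∅) (h : chainCarrier E ⊆ G) :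
    insert G E ∈ (simplex V).barycentric.faces := by
  rw [mem_barycentric_simplex] at hE ⊢
  rw [chainCarrier_subset_iff] at h
  refine ⟨fun h0 => ?_, fun A hA B hB => ?_⟩
  · rcases Finset.mem_insert.1 h0 with h1 | h1
    · exact hG h1.symm
    · exact hE.1 h1
  · rcases Finset.mem_insert.1 hA with rfl | hA
    · rcases Finset.mem_insert.1 hB with rfl | hB
      · exact Or.inl subset_rfl
      · exact Or.inr (h B hB)
    · rcases Finset.mem_insert.1 hB with rfl | hB
      · exact Or.inl (h A ‹_›)
      · exact hE.2 A hA B hB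

theorem exists_maximal_chain (F : Finset V) : ∃ E ∈ (simplex V).barycentric.faces,
    chainCarrier E ⊆ F ∧ E.card = F.card := by
  induction F using Finset.induction_on with
  | empty => exact ⟨∅, by simp [mem_barycentric_simplex], by simp [chainCarrier], rfl⟩
  | insert v F hv ih =>
    obtain ⟨E, hE, hEF, hcard⟩ := ih
    have hsub : chainCarrier E ⊆ insert v F := hEF.trans (Finset.subset_insert _ _)
    refine ⟨insert (insert v F) E, insert_mem_barycentric hE (Finset.insert_ne_empty _ _) hsub,
      (chainCarrier_insert hsub).le, ?_⟩
    rw [Finset.card_insert_of_notMem, Finset.card_insert_of_notMem hv, hcard]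
    intro h
    exact hv (hEF (subset_chainCarrier h (Finset.mem_insert_self _ _)))

theorem rank_restrict (F : Finset V) : ((simplex V).barycentric.restrict chainCarrier
    chainCarrier_mono F).rank = F.card := by
  refine le_antisymm (Finset.sup_le fun E hE => ?_) ?_
  · rw [FinComplex.restrict, Finset.mem_filter] at hE
    exact (card_le_card_chainCarrier hE.1).trans (Finset.card_le_card hE.2)
  · obtain ⟨E, hE, hEF, hcard⟩ := exists_maximal_chain F
    rw [← hcard]
    exact Finset.le_sup (f := Finset.card) (Finset.mem_filter.2 ⟨hE, hEF⟩)

/-- The part of the `h`-polynomial of the restriction to `G` that comes from the chains with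
carrier `G`. -/
noncomputable def topPoly (G : Finset V) : ℤ[X] :=
  ∑ E ∈ (simplex V).barycentric.faces with chainCarrier E = G,
    X ^ E.card * (1 - X) ^ (G.card - E.card)

theorem hPoly_restrict (F : Finset V) :
    ((simplex V).barycentric.restrict chainCarrier chainCarrier_mono F).hPoly =
      ∑ E ∈ (simplex V).barycentric.faces with chainCarrier E ⊆ F,
        X ^ E.card * (1 - X) ^ (F.card - E.card) := by
  rw [FinComplex.hPoly, rank_restrict, FinComplex.restrict]

theorem hPoly_restrict_eq_sum_topPoly (F : Finset V) :
    ((simplex V).barycentric.restrict chainCarrier chainCarrier_mono F).hPoly =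
      ∑ G ∈ F.powerset, topPoly G * (1 - X) ^ (F.card - G.card) := by
  rw [hPoly_restrict, ← Finset.sum_fiberwise_of_maps_to (g := chainCarrier) (t := F.powerset)
    (fun E hE => Finset.mem_powerset.2 (Finset.mem_filter.1 hE).2)]
  refine Finset.sum_congr rfl fun G hG => ?_
  rw [Finset.mem_powerset] at hG
  rw [topPoly, Finset.sum_mul, Finset.filter_filter]
  refine Finset.sum_congr ?_ fun E hE => ?_
  · ext E
    simp only [Finset.mem_filter, and_congr_right_iff]
    exact fun _ => ⟨fun h => h.2, fun h => ⟨h ▸ hG, h⟩⟩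
  · rw [Finset.mem_filter] at hE
    have h1 := card_le_card_chainCarrier hE.1
    rw [hE.2] at h1
    rw [mul_assoc, ← pow_add]
    congr 2
    have := Finset.card_le_card hG
    omega

theorem topPoly_empty : topPoly (∅ : Finset V) = 1 := by
  have : (simplex V).barycentric.faces.filter (fun E => chainCarrier E = ∅) = {∅} := by
    ext E
    rw [Finset.mem_filter, Finset.mem_singleton]
    constructor
    · rintro ⟨hE, h⟩
      by_contra hne
      have := chainCarrier_mem hE (Finset.nonempty_iff_ne_empty.2 hne)
      rw [h] at this
      exact (mem_barycentric_simplex.1 hE).1 this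
    · rintro rfl
      simp [mem_barycentric_simplex, chainCarrier]
  rw [topPoly, this]
  simp

/-- Deleting `G` matches the chains with carrier `G` with those of carrier strictly inside `G`,
whence (1 - X) top = X (h - top). -/
theorem topPoly_eq {G : Finset V} (hG : G ≠ ∅) : topPoly G = X *
    ((simplex V).barycentric.restrict chainCarrier chainCarrier_mono G).hPoly := by
  have hsplit : ((simplex V).barycentric.restrict chainCarrier chainCarrier_mono G).hPoly =
      topPoly G + ∑ E ∈ (simplex V).barycentric.faces with chainCarrier E ⊂ G,
        X ^ E.card * (1 - X) ^ (G.card - E.card) := by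
    rw [hPoly_restrict, topPoly, ← Finset.sum_union]
    · congr 1
      ext E
      simp only [Finset.mem_filter, Finset.mem_union, ← and_or_left]
      rw [subset_iff_ssubset_or_eq, or_comm]
    · rw [Finset.disjoint_filter]
      exact fun E _ h1 h2 => h2.ne h1
  have hbij : (1 - X) * topPoly G = X *
      ∑ E ∈ (simplex V).barycentric.faces with chainCarrier E ⊂ G,
        X ^ E.card * (1 - X) ^ (G.card - E.card) := by
    rw [topPoly, Finset.mul_sum, Finset.mul_sum]
    symm
    have hnot : ∀ E : Finset (Finset V), chainCarrier E ⊂ G → G ∉ E := fun E h hGE =>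
      h.2 (subset_chainCarrier hGE)
    refine Finset.sum_bij' (fun E _ => insert G E) (fun E _ => E.erase G) ?_ ?_ ?_ ?_ ?_
    · intro E hE
      rw [Finset.mem_filter] at hE ⊢
      exact ⟨insert_mem_barycentric hE.1 hG hE.2.1, chainCarrier_insert hE.2.1⟩
    · intro E hE
      rw [Finset.mem_filter] at hE ⊢
      have hmem := (simplex V).barycentric.down_closed _ _ hE.1 (E.erase_subset G)
      have hsub : chainCarrier (E.erase G) ⊆ G := by
        rw [← hE.2]
        exact chainCarrier_mono (Finset.erase_subset _ _)
      refine ⟨hmem, hsub.ssubset_of_ne fun h => ?_⟩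
      rcases (E.erase G).eq_empty_or_nonempty with h0 | h0
      · rw [h0] at h
        exact hG h.symm
      · have := chainCarrier_mem hmem h0
        rw [h] at this
        exact Finset.notMem_erase _ _ this
    · intro E hE
      exact Finset.erase_insert (hnot E (Finset.mem_filter.1 hE).2)
    · intro E hE
      rw [Finset.mem_filter] at hE
      refine Finset.insert_erase ?_
      have h0 : E.Nonempty := by
        rw [Finset.nonempty_iff_ne_empty]
        rintro rfl
        exact hG hE.2.symm
      have := chainCarrier_mem hE.1 h0
      rwa [hE.2] at this
    · intro E hE
      rw [Finset.mem_filter] at hE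
      have h1 := card_le_card_chainCarrier hE.1
      have h2 := Finset.card_lt_card hE.2
      rw [Finset.card_insert_of_notMem (hnot E hE.2),
        show G.card - E.card = G.card - (E.card + 1) + 1 by omega]
      ring
  linear_combination hbij - X * hsplit

/-- Chains are sorted by carrier. The last summand corrects the term of the empty carrier, where
`topPoly` is 1 instead of X. -/
theorem hPoly_restrict_recurrence (F : Finset V) :
    ((simplex V).barycentric.restrict chainCarrier chainCarrier_mono F).hPoly =
      ∑ G ∈ F.powerset, X *
        ((simplex V).barycentric.restrict chainCarrier chainCarrier_mono G).hPoly *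
          (1 - X) ^ (F.card - G.card) + (1 - X) ^ (F.card + 1) := by
  have h0 : ((simplex V).barycentric.restrict chainCarrier chainCarrier_mono ∅).hPoly = 1 := by
    rw [hPoly_restrict_eq_sum_topPoly]
    simp [topPoly_empty]
  rw [hPoly_restrict_eq_sum_topPoly F, ← Finset.add_sum_erase _ _ (Finset.empty_mem_powerset F),
    ← Finset.add_sum_erase (a := ∅) _ _ (Finset.empty_mem_powerset F), topPoly_empty, h0]
  have : ∑ G ∈ F.powerset.erase ∅, topPoly G * (1 - X) ^ (F.card - G.card) =
      ∑ G ∈ F.powerset.erase ∅, X *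
        ((simplex V).barycentric.restrict chainCarrier chainCarrier_mono G).hPoly *
          (1 - X) ^ (F.card - G.card) :=
    Finset.sum_congr rfl fun G hG => by rw [topPoly_eq (Finset.ne_of_mem_erase hG)]
  rw [this, Finset.card_empty, Nat.sub_zero]
  ring

theorem hPoly_restrict_eq_sum_gammaSum (F : Finset V) :
    ((simplex V).barycentric.restrict chainCarrier chainCarrier_mono F).hPoly =
      ∑ G ∈ F.powerset, gammaSum X (1 + X) G.card := by
  let A : ℕ → ℤ[X] := fun n => ∑ ij ∈ Finset.HasAntidiagonal.antidiagonal n,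
    (n.choose ij.1 : ℤ[X]) * gammaSum X (1 + X) ij.2
  rw [← sum_antidiagonal_choose_eq_sum_powerset F (fun _ j => gammaSum X (1 + X) j)]
  change _ = A F.card
  induction F using Finset.strongInduction with
  | H F ih =>
    have h1 := hPoly_restrict_recurrence F
    have h2 := eulerian_recurrence (A := A) (fun _ => rfl) F.card
    rw [sum_antidiagonal_choose_eq_sum_powerset F (fun i j => X * (1 - X) ^ i * A j)] at h2
    -- The summand G = F contains X times the unknown; moving it to the left leaves the factor 1 -
    -- X, which can be cancelled.
    rw [← Finset.add_sum_erase _ _ (Finset.mem_powerset_self F)] at h1 h2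
    have h3 : ∑ G ∈ F.powerset.erase F, X *
        ((simplex V).barycentric.restrict chainCarrier chainCarrier_mono G).hPoly *
          (1 - X) ^ (F.card - G.card) =
        ∑ G ∈ F.powerset.erase F, X * (1 - X) ^ (F.card - G.card) * A G.card := by
      refine Finset.sum_congr rfl fun G hG => ?_
      rw [Finset.mem_erase, Finset.mem_powerset] at hG
      rw [ih G (hG.2.ssubset_of_ne hG.1)]
      ring
    rw [h3] at h1
    have hX : (1 - X : ℤ[X]) ≠ 0 := fun h => by simpa using congrArg (eval 0) h
    refine mul_left_cancel₀ hX ?_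
    rw [Nat.sub_self, pow_zero] at h1 h2
    linear_combination h1 - h2

theorem baryLocalHPoly_eq : baryLocalHPoly V = gammaSum X (1 + X) (Fintype.card V) := by
  rw [baryLocalHPoly, localHPoly, ← Equiv.sum_comp (compl_involutive.toPerm _)]
  have h1 : ∀ S : Finset V, (-1 : ℤ[X]) ^ (Fintype.card V - (Sᶜ).card) *
      ((simplex V).barycentric.restrict chainCarrier chainCarrier_mono Sᶜ).hPoly =
      ∑ G ∈ Sᶜ.powerset, (-1) ^ S.card * gammaSum X (1 + X) G.card := fun S => by
    rw [hPoly_restrict_eq_sum_gammaSum, Finset.mul_sum, Finset.card_compl,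
      Nat.sub_sub_self (Finset.card_le_univ S)]
  simp only [Function.Involutive.coe_toPerm, h1]
  rw [Finset.sum_comm' (t' := Finset.univ) (s' := fun G => Gᶜ.powerset)]
  -- After F is replaced by its complement S, the alternating sum over S ⊆ Gᶜ vanishes unless G is
  -- everything.
  · have h2 : ∀ G : Finset V, ∑ S ∈ Gᶜ.powerset, (-1 : ℤ[X]) ^ S.card *
        gammaSum X (1 + X) G.card = if G = Finset.univ then gammaSum X (1 + X) G.card else 0 := by
      intro G
      have := congrArg (Int.cast : ℤ → ℤ[X]) (Finset.sum_powerset_neg_one_pow_card (x := Gᶜ))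
      push_cast at this
      rw [← Finset.sum_mul, this]
      simp [Finset.compl_eq_empty_iff]
    simp only [h2]
    simp
  · intro S G
    simp [Finset.subset_compl_comm]

end Barycentric

/-! ### The permutation statistics -/

/-- Counting by a statistic from its generating polynomial. -/
theorem ncard_eq_gammaNum {n : ℕ} {g : Equiv.Perm (Fin n) → ℤ[X]} {s : Equiv.Perm (Fin n) → ℕ}
    {P : Equiv.Perm (Fin n) → Prop} (h1 : ∀ w, P w → g w = X ^ s w) (h0 : ∀ w, ¬ P w → g w = 0)
    (hg : ∑ w, g w = gammaSum X 1 n) {i : ℕ} (hi : i ≤ n) :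
    {w | s w = i ∧ P w}.ncard = gammaNum n i := by
  classical
  have h := congrArg (fun p => coeff p i) hg
  simp only [finsetSum_coeff, gammaSum, one_pow, mul_one, coeff_natCast_mul, coeff_X_pow] at h
  rw [Finset.sum_eq_single i (fun j _ hj => by simp [hj.symm])
    (fun hn => absurd (Finset.mem_range.2 (Nat.lt_succ_of_le hi)) hn)] at h
  have h2 : ∀ w, (g w).coeff i = if s w = i ∧ P w then 1 else 0 := by
    intro w
    by_cases hP : P w
    · simp [h1 w hP, hP, coeff_X_pow, eq_comm]
    · simp [h0 w hP, hP]
  simp only [h2, Finset.sum_boole, if_true, mul_one] at h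
  rw [Set.ncard_eq_toFinset_card', Set.toFinset_ofPred]
  exact_mod_cast h

open Classical in
theorem prod_ite_X_one {n : ℕ} (P : Fin n → Prop) :
    ∏ i, (if P i then X else 1 : ℤ[X]) = X ^ {i | P i}.ncard := by
  rw [Finset.prod_ite, Finset.prod_const, Finset.prod_const_one, mul_one,
    Set.ncard_eq_toFinset_card', Set.toFinset_ofPred]

theorem mem_derangements_iff {n : ℕ} {w : Equiv.Perm (Fin n)} :
    w ∈ derangements (Fin n) ↔ ∀ i, w i ≠ i := Iff.rfl

/-- Here a = 0 excludes double excedances and f = 0 fixed points; the remaining excedances are the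
cyclic valleys, marked by X. -/
theorem ncard_derangements {n i : ℕ} (hi : i ≤ n) :
    {w : Equiv.Perm (Fin n) | w ∈ derangements (Fin n) ∧ exc w = i ∧
      ∀ j, ¬ IsDoubleExcedance w j}.ncard = gammaNum n i := by
  have hset : {w : Equiv.Perm (Fin n) | w ∈ derangements (Fin n) ∧ exc w = i ∧
      ∀ j, ¬ IsDoubleExcedance w j} = {w : Equiv.Perm (Fin n) | exc w = i ∧
        ((∀ j, w j ≠ j) ∧ ∀ j, ¬ IsDoubleExcedance w j)} := by
    ext w
    simp only [Set.mem_ofPred_eq, mem_derangements_iff]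
    tauto
  rw [hset]
  have hsum := sum_permWeight_derangements (X : ℤ[X]) 0 1 n
  rw [zero_add] at hsum
  refine ncard_eq_gammaNum (fun w hw => ?_) (fun w hw => ?_) hsum hi
  · rw [exc, ← prod_ite_X_one, permWeight]
    refine Finset.prod_congr rfl fun j _ => ?_
    have h1 := hw.1 j
    have h2 : j < w j → ¬ w.symm j < j := fun h h' => hw.2 j ⟨h, h'⟩
    unfold cycWeight IsExcedance
    rcases lt_or_gt_of_ne h1 with h | h
    · simp [h.not_gt, h]
    · simp [h, h2 h]
  · rw [not_and_or] at hw
    rw [permWeight]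
    rcases hw with hw | hw
    · push Not at hw
      obtain ⟨j, hj⟩ := hw
      exact Finset.prod_eq_zero (Finset.mem_univ j) (by simp [cycWeight, hj])
    · push Not at hw
      obtain ⟨j, hj, hj'⟩ := hw
      have hj' : w.symm j < j := hj'
      exact Finset.prod_eq_zero (Finset.mem_univ j) (by simp [cycWeight, hj, hj'])

theorem derangementPoly_eq (n : ℕ) : derangementPoly n = gammaSum X (1 + X) n := by
  classical
  rw [add_comm, ← sum_permWeight_derangements, derangementPoly]
  have h0 : ∀ w : Equiv.Perm (Fin n), w ∉ derangements (Fin n) →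
      permWeight (X : ℤ[X]) X 1 0 w = 0 := by
    intro w hw
    rw [mem_derangements_iff] at hw
    push Not at hw
    obtain ⟨j, hj⟩ := hw
    exact Finset.prod_eq_zero (Finset.mem_univ j) (by simp [cycWeight, hj])
  have h1 : ∀ w : Equiv.Perm (Fin n), w ∈ derangements (Fin n) →
      permWeight (X : ℤ[X]) X 1 0 w = X ^ exc w := by
    intro w hw
    rw [mem_derangements_iff] at hw
    rw [exc, ← prod_ite_X_one, permWeight]
    refine Finset.prod_congr rfl fun j _ => ?_
    unfold cycWeight IsExcedance
    rcases lt_or_gt_of_ne (hw j) with h | h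
    · simp [h.not_gt, h]
    · simp [h]
  have h2 : ∑ w : Equiv.Perm (Fin n), permWeight (X : ℤ[X]) X 1 0 w =
      ∑ w : Equiv.Perm (Fin n) with w ∈ derangements (Fin n), X ^ exc w := by
    rw [Finset.sum_filter]
    refine Finset.sum_congr rfl fun w _ => ?_
    split_ifs with h
    · exact h1 w h
    · exact h0 w h
  rw [h2]
  symm
  exact Finset.sum_subtype _ (by simp) _

theorem not_isDescent_iff {n : ℕ} {w : Equiv.Perm (Fin n)} {i : Fin n} :
    ¬ IsDescent w i ↔ ∀ k : Fin n, (i : ℕ) + 1 = k → w i < w k := by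
  unfold IsDescent
  push Not
  refine forall_congr' fun k => imp_congr_right fun hk => ?_
  have : w i ≠ w k := fun h => by
    have := congrArg Fin.val (w.injective h)
    omega
  exact ⟨fun h => h.lt_of_ne this, le_of_lt⟩

/-- Descents are counted at position i + 1, because the weight looks at whether the previous letter
is larger. -/
theorem des_eq_ncard {n : ℕ} (w : Equiv.Perm (Fin n)) :
    des w = {i : Fin n | ¬ ∀ j : Fin n, (j : ℕ) + 1 = i → w j < w i}.ncard := by
  have hlt : ∀ i, IsDescent w i → (i : ℕ) + 1 < n := by
    rintro i ⟨k, hk, -⟩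
    have := k.2
    omega
  refine Set.ncard_congr (fun i hi => ⟨(i : ℕ) + 1, hlt i hi⟩) ?_ ?_ ?_
  · rintro i ⟨k, hk, hlt⟩ h
    have := h i rfl
    have hk' : (⟨(i : ℕ) + 1, by omega⟩ : Fin n) = k := Fin.ext hk
    rw [hk'] at this
    exact this.not_gt hlt
  · intro i j _ _ h
    simpa [Fin.ext_iff] using h
  · intro k hk
    simp only [Set.mem_ofPred_eq, not_forall] at hk
    obtain ⟨j, hj, hjk⟩ := hk
    have hne : w j ≠ w k := fun h => by
      have := congrArg Fin.val (w.injective h)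
      omega
    exact ⟨j, ⟨k, hj, (not_lt.1 hjk).lt_of_ne hne.symm⟩, Fin.ext hj⟩

theorem isDoubleDescent_iff {n : ℕ} {w : Equiv.Perm (Fin n)} {i : Fin n} :
    IsDoubleDescent w i ↔ (¬ ∀ j : Fin n, (j : ℕ) + 1 = i → w j < w i) ∧ IsDescent w i := by
  constructor
  · rintro ⟨j, k, hj, hk, h1, h2⟩
    exact ⟨fun h => (h j hj).not_gt h1, k, hk, h2⟩
  · rintro ⟨h, k, hk, h2⟩
    simp only [not_forall] at h
    obtain ⟨j, hj, hji⟩ := h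
    have hne : w j ≠ w i := fun h => by
      have := congrArg Fin.val (w.injective h)
      omega
    exact ⟨j, k, hj, hk, (not_lt.1 hji).lt_of_ne hne.symm, h2⟩

/-- Here b = 0 excludes double descents. A left-to-right maximum exceeds its predecessor, so it has
weight f = 0 exactly when it is not a descent. -/
theorem ncard_descents {n i : ℕ} (hi : i ≤ n) :
    {w : Equiv.Perm (Fin n) | des w = i ∧ (∀ j, ¬ IsDoubleDescent w j) ∧
      ∀ j, IsLeftToRightMax w j → IsDescent w j}.ncard = gammaNum n i := by
  have hsum := sum_wordWeight (X : ℤ[X]) 1 0 n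
  rw [add_zero] at hsum
  refine ncard_eq_gammaNum (fun w hw => ?_) (fun w hw => ?_) hsum hi
  · rw [des_eq_ncard, ← prod_ite_X_one, wordWeight_ofFn]
    refine Finset.prod_congr rfl fun j _ => ?_
    have h1 := hw.1 j
    have h2 := hw.2 j
    rw [isDoubleDescent_iff] at h1
    simp only [← not_isDescent_iff, WithBot.bot_lt_coe, implies_true, and_true]
    change IsLeftToRightMax w j → _ at h2
    change letterWeight X 1 0 0 _ _ (IsLeftToRightMax w j) = _
    unfold letterWeight
    split_ifs <;> tauto
  · rw [wordWeight_ofFn]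
    simp only [← not_isDescent_iff, WithBot.bot_lt_coe, implies_true, and_true]
    rw [not_and_or] at hw
    rcases hw with hw | hw
    · push Not at hw
      obtain ⟨j, hj⟩ := hw
      rw [isDoubleDescent_iff] at hj
      refine Finset.prod_eq_zero (Finset.mem_univ j) ?_
      rw [letterWeight, if_neg (not_not.2 hj.2), if_neg hj.1]
    · push Not at hw
      obtain ⟨j, hj, hj'⟩ := hw
      refine Finset.prod_eq_zero (Finset.mem_univ j) ?_
      change letterWeight X 1 0 0 _ _ (IsLeftToRightMax w j) = 0
      rw [letterWeight, if_pos hj', if_pos, if_pos hj]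
      exact fun k hk => hj k (Fin.lt_def.2 (by omega))

/-! ### Ascending runs -/

section Runs

variable {n : ℕ} {w : Equiv.Perm (Fin n)}

/-- `i` is the first position of an ascending run. -/
def IsRunStart (w : Equiv.Perm (Fin n)) (i : Fin n) : Prop :=
  ∀ j : Fin n, (j : ℕ) + 1 = i → w i < w j

/-- `i` is the last position of an ascending run. -/
def IsRunEnd (w : Equiv.Perm (Fin n)) (i : Fin n) : Prop :=
  ∀ k : Fin n, (i : ℕ) + 1 = k → w k < w i

theorem strictMonoOn_Icc_succ {i j k : Fin n} (hij : i ≤ j) (hjk : (j : ℕ) + 1 = k)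
    (hw : StrictMonoOn w (Finset.Icc i j : Set (Fin n))) (h : w j < w k) :
    StrictMonoOn w (Finset.Icc i k : Set (Fin n)) := by
  simp only [Finset.coe_Icc] at hw ⊢
  intro x hx y hy hxy
  rcases hy.2.eq_or_lt with rfl | hyk
  · have hxj : x ≤ j := Fin.le_def.2 (by have := Fin.lt_def.1 hxy; omega)
    exact (hw.monotoneOn ⟨hx.1, hxj⟩ ⟨hij, le_rfl⟩ hxj).trans_lt h
  · have hyj : y ≤ j := Fin.le_def.2 (by have := Fin.lt_def.1 hyk; omega)
    exact hw ⟨hx.1, hxy.le.trans hyj⟩ ⟨hy.1, hyj⟩ hxy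

theorem strictMonoOn_Icc_pred {i j k : Fin n} (hij : i ≤ j) (hki : (k : ℕ) + 1 = i)
    (hw : StrictMonoOn w (Finset.Icc i j : Set (Fin n))) (h : w k < w i) :
    StrictMonoOn w (Finset.Icc k j : Set (Fin n)) := by
  simp only [Finset.coe_Icc] at hw ⊢
  intro x hx y hy hxy
  rcases hx.1.eq_or_lt with rfl | hkx
  · have hiy : i ≤ y := Fin.le_def.2 (by have := Fin.lt_def.1 hxy; omega)
    exact h.trans_le (hw.monotoneOn ⟨le_rfl, hij⟩ ⟨hiy, hy.2⟩ hiy)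
  · have hix : i ≤ x := Fin.le_def.2 (by have := Fin.lt_def.1 hkx; omega)
    exact hw ⟨hix, hx.2⟩ ⟨hix.trans hxy.le, hy.2⟩ hxy

theorem IsRunStart.le_of_strictMonoOn {i k j : Fin n} (hi : IsRunStart w i) (hij : i ≤ j)
    (hw : StrictMonoOn w (Finset.Icc k j : Set (Fin n))) : i ≤ k := by
  by_contra! h
  have h' := Fin.lt_def.1 h
  have hl : (⟨(i : ℕ) - 1, by omega⟩ : Fin n) < i := Fin.lt_def.2 (by simp only; omega)
  refine (hi ⟨(i : ℕ) - 1, by omega⟩ (by simp only; omega)).not_gt (hw ?_ ?_ hl)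
  · rw [Finset.coe_Icc]
    exact ⟨Fin.le_def.2 (by simp only; omega), hl.le.trans hij⟩
  · rw [Finset.coe_Icc]
    exact ⟨h.le, hij⟩

theorem IsRunEnd.le_of_strictMonoOn {i k j : Fin n} (hj : IsRunEnd w j) (hij : i ≤ j)
    (hw : StrictMonoOn w (Finset.Icc i k : Set (Fin n))) : k ≤ j := by
  by_contra! h
  have h' := Fin.lt_def.1 h
  have hl : j < (⟨(j : ℕ) + 1, by omega⟩ : Fin n) := Fin.lt_def.2 (by simp only; omega)
  refine (hj ⟨(j : ℕ) + 1, by omega⟩ rfl).not_gt (hw ?_ ?_ hl)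
  · rw [Finset.coe_Icc]
    exact ⟨hij, h.le⟩
  · rw [Finset.coe_Icc]
    exact ⟨hij.trans hl.le, Fin.le_def.2 (by simp only; omega)⟩

/-- An interval of increase is maximal as soon as neither end can be moved by one position. -/
theorem isRun_iff {S : Finset (Fin n)} : IsRun w S ↔ ∃ i j : Fin n, i ≤ j ∧ S = Finset.Icc i j ∧
    StrictMonoOn w (Finset.Icc i j : Set (Fin n)) ∧ IsRunStart w i ∧ IsRunEnd w j := by
  have hne : ∀ {i j : Fin n}, (i : ℕ) + 1 = j → w i ≠ w j := fun h h' => by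
    have := congrArg Fin.val (w.injective h')
    omega
  constructor
  · rintro ⟨⟨i, j, hij, rfl, hw⟩, hmax⟩
    refine ⟨i, j, hij, rfl, hw, fun k hk => ?_, fun k hk => ?_⟩
    · by_contra! h
      have hki : k < i := Fin.lt_def.2 (by omega)
      have := hmax ⟨k, j, hki.le.trans hij, rfl,
        strictMonoOn_Icc_pred hij hk hw (h.lt_of_ne (hne hk))⟩
        (Finset.Icc_subset_Icc_left hki.le) (Finset.left_mem_Icc.2 (hki.le.trans hij))
      exact (Finset.mem_Icc.1 this).1.not_gt hki
    · by_contra! h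
      have hjk : j < k := Fin.lt_def.2 (by omega)
      have := hmax ⟨i, k, hij.trans hjk.le, rfl,
        strictMonoOn_Icc_succ hij hk hw (h.lt_of_ne (hne hk))⟩
        (Finset.Icc_subset_Icc_right hjk.le) (Finset.right_mem_Icc.2 (hij.trans hjk.le))
      exact (Finset.mem_Icc.1 this).2.not_gt hjk
  · rintro ⟨i, j, hij, rfl, hw, hi, hj⟩
    refine ⟨⟨i, j, hij, rfl, hw⟩, ?_⟩
    rintro T ⟨k, l, hkl, rfl, hw'⟩ hsub
    have hsub : Finset.Icc i j ⊆ Finset.Icc k l := hsub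
    rw [Finset.Icc_subset_Icc_iff hij] at hsub
    refine Finset.Icc_subset_Icc ?_ ?_
    · exact hi.le_of_strictMonoOn (hij.trans hsub.2) hw'
    · exact hj.le_of_strictMonoOn (hsub.1.trans hij) hw'

theorem exists_runStart (w : Equiv.Perm (Fin n)) (j : Fin n) : ∃ i ≤ j, IsRunStart w i ∧
    StrictMonoOn w (Finset.Icc i j : Set (Fin n)) := by
  obtain ⟨j, hj⟩ := j
  induction j with
  | zero => exact ⟨_, le_rfl, fun k hk => absurd hk (by simp), by simp⟩
  | succ j ih =>
    by_cases h : IsRunStart w ⟨j + 1, hj⟩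
    · exact ⟨_, le_rfl, h, by simp⟩
    · obtain ⟨i, hij, hi, hw⟩ := ih (by omega)
      have hlt : w ⟨j, by omega⟩ < w ⟨j + 1, hj⟩ := by
        simp only [IsRunStart, not_forall] at h
        obtain ⟨k, hk, hkj⟩ := h
        have hk' : k = ⟨j, by omega⟩ := Fin.ext (by simpa using hk)
        rw [hk'] at hkj
        refine (not_lt.1 hkj).lt_of_ne fun h' => ?_
        simpa using w.injective h'
      exact ⟨i, hij.trans (Fin.le_def.2 (by simp)), hi, strictMonoOn_Icc_succ hij rfl hw hlt⟩

/-- A run is determined by its last position, and every position is reached increasingly from some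
run start. -/
theorem runs_eq_ncard (w : Equiv.Perm (Fin n)) : runs w = {j | IsRunEnd w j}.ncard := by
  choose st hle hst hmono using exists_runStart w
  have himage : {S | IsRun w S} = (fun j => Finset.Icc (st j) j) '' {j | IsRunEnd w j} := by
    ext S
    simp only [Set.mem_ofPred_eq, Set.mem_image, isRun_iff]
    constructor
    · rintro ⟨i, j, hij, rfl, hw, hi, hj⟩
      refine ⟨j, hj, ?_⟩
      rw [((hst j).le_of_strictMonoOn (hle j) hw).antisymm (hi.le_of_strictMonoOn hij (hmono j))]
    · rintro ⟨j, hj, rfl⟩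
      exact ⟨st j, j, hle j, rfl, hmono j, hst j, hj⟩
  rw [runs, himage, Set.InjOn.ncard_image]
  intro j _ k _ h
  have h : Finset.Icc (st j) j = Finset.Icc (st k) k := h
  have h1 := (Finset.Icc_subset_Icc_iff (hle j)).1 h.le
  have h2 := (Finset.Icc_subset_Icc_iff (hle k)).1 h.ge
  exact h1.2.antisymm h2.2

theorem forall_run_card_ne_one (w : Equiv.Perm (Fin n)) :
    (∀ S, IsRun w S → S.card ≠ 1) ↔ ∀ j, ¬ (IsRunStart w j ∧ IsRunEnd w j) := by
  constructor
  · rintro h j ⟨h1, h2⟩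
    exact h {j} (isRun_iff.2 ⟨j, j, le_rfl, by simp, by simp, h1, h2⟩) (by simp)
  · intro h S hS hcard
    obtain ⟨i, j, hij, rfl, -, hi, hj⟩ := isRun_iff.1 hS
    rw [Fin.card_Icc] at hcard
    have : i = j := Fin.ext (by have := Fin.le_def.1 hij; omega)
    subst this
    exact h i ⟨hi, hj⟩

/-- Complementing the values turns run starts into letters above their predecessor and run ends into
letters below their successor. With a = f = 0 a run of length one has weight 0, and every other run
end has weight X. -/
theorem ncard_runs {i : ℕ} (hi : i ≤ n) :
    {w : Equiv.Perm (Fin n) | runs w = i ∧ ∀ S, IsRun w S → S.card ≠ 1}.ncard = gammaNum n i := by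
  simp only [forall_run_card_ne_one]
  have hsum := sum_wordWeight (X : ℤ[X]) 0 1 n
  rw [zero_add, ← Equiv.sum_comp (Equiv.mulLeft Fin.revPerm)] at hsum
  have key : ∀ w : Equiv.Perm (Fin n), wordWeight (X : ℤ[X]) 0 1 0 ⊥ ⊥
      (List.ofFn (Equiv.mulLeft Fin.revPerm w : Equiv.Perm (Fin n))) =
      ∏ j, letterWeight X 0 1 0 (IsRunStart w j) (IsRunEnd w j) True := by
    intro w
    rw [wordWeight_ofFn]
    refine Finset.prod_congr rfl fun j _ => ?_
    have hM : ∀ P Q M : Prop, letterWeight (X : ℤ[X]) 0 1 0 P Q M =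
        letterWeight X 0 1 0 P Q True := fun P Q M => by
      unfold letterWeight
      split_ifs <;> rfl
    rw [hM]
    congr 1 <;> simp [IsRunStart, IsRunEnd]
  simp only [key] at hsum
  refine ncard_eq_gammaNum (fun w hw => ?_) (fun w hw => ?_) hsum hi
  · rw [runs_eq_ncard, ← prod_ite_X_one]
    refine Finset.prod_congr rfl fun j _ => ?_
    have := hw j
    unfold letterWeight
    split_ifs <;> tauto
  · push Not at hw
    obtain ⟨j, h1, h2⟩ := hw
    refine Finset.prod_eq_zero (Finset.mem_univ j) ?_
    simp [letterWeight, h1, h2]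

end Runs

/-! ### Uniqueness of the `γ`-vector and unimodality -/

theorem isGammaVector_gammaSum (n : ℕ) :
    IsGammaVector n (gammaSum X (1 + X) n) fun i => (gammaNum n i : ℤ) := by
  rw [IsGammaVector, Fin.sum_univ_eq_sum_range
    (fun i => C (gammaNum n i : ℤ) * X ^ i * (1 + X : ℤ[X]) ^ (n - 2 * i)), gammaSum]
  symm
  refine Finset.sum_subset_zero_on_sdiff ?_ ?_ ?_
  · intro i hi
    rw [Finset.mem_range] at hi ⊢
    omega
  · intro i hi
    rw [Finset.mem_sdiff, Finset.mem_range, Finset.mem_range] at hi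
    rw [gammaNum_eq_zero (by omega)]
    simp
  · intro i _
    simp [mul_assoc]

/-- The basis is triangular: x^i(1+x)^(n-2i) has lowest term x^i, so the coefficients are determined
in increasing order of i. -/
theorem IsGammaVector.unique {n : ℕ} {p : ℤ[X]} {ξ ζ : Fin (n / 2 + 1) → ℤ}
    (hξ : IsGammaVector n p ξ) (hζ : IsGammaVector n p ζ) : ξ = ζ := by
  have h : ∑ i : Fin (n / 2 + 1),
      C (ξ i - ζ i) * X ^ (i : ℕ) * (1 + X : ℤ[X]) ^ (n - 2 * (i : ℕ)) = 0 := by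
    simp only [C_sub, sub_mul, Finset.sum_sub_distrib]
    rw [← hξ, ← hζ, sub_self]
  have key : ∀ m : ℕ, ∀ i : Fin (n / 2 + 1), (i : ℕ) = m → ξ i - ζ i = 0 := by
    intro m
    induction m using Nat.strong_induction_on with
    | _ m ih =>
      intro i hi
      have hc := congrArg (fun q => coeff q m) h
      simp only [finsetSum_coeff, coeff_zero] at hc
      rw [Finset.sum_eq_single i] at hc
      · rw [mul_assoc, coeff_C_mul, hi, coeff_X_pow_mul', if_pos le_rfl, Nat.sub_self,
          coeff_zero_eq_eval_zero] at hc
        simpa using hc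
      · intro j _ hj
        rcases lt_or_gt_of_ne (fun h' => hj (Fin.ext h') : (j : ℕ) ≠ i) with h1 | h1
        · rw [ih j (hi ▸ h1) j rfl]
          simp
        · rw [mul_assoc, coeff_C_mul, coeff_X_pow_mul', if_neg (by omega), mul_zero]
      · simp
  funext i
  exact sub_eq_zero.1 (key i i rfl)

theorem coeff_gammaSum (n k : ℕ) : (gammaSum X (1 + X : ℤ[X]) n).coeff k =
    ∑ i ∈ Finset.range (n + 1),
      (gammaNum n i : ℤ) * (if i ≤ k then ((n - 2 * i).choose (k - i) : ℤ) else 0) := by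
  rw [gammaSum, finsetSum_coeff]
  refine Finset.sum_congr rfl fun i _ => ?_
  rw [coeff_natCast_mul, coeff_X_pow_mul']
  simp [coeff_one_add_X_pow]

theorem choose_succ_le_of_half_le {N r : ℕ} (h : N ≤ 2 * r + 1) :
    N.choose (r + 1) ≤ N.choose r := by
  have h1 := Nat.choose_succ_right_eq N r
  have h2 : N - r ≤ r + 1 := by omega
  refine Nat.le_of_mul_le_mul_right (c := r + 1) ?_ (Nat.succ_pos r)
  rw [h1]
  exact Nat.mul_le_mul_left _ h2

theorem choose_le_succ_of_lt_half {N r : ℕ} (h : 2 * r + 1 ≤ N) :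
    N.choose r ≤ N.choose (r + 1) := by
  have h1 := Nat.choose_succ_right_eq N r
  have h2 : r + 1 ≤ N - r := by omega
  refine Nat.le_of_mul_le_mul_right (c := r + 1) ?_ (Nat.succ_pos r)
  rw [h1]
  exact Nat.mul_le_mul_left _ h2

theorem isUnimodal_gammaSum (n : ℕ) : IsUnimodal (gammaSum X (1 + X) n) := by
  refine ⟨n / 2, ?_, ?_⟩
  · refine monotoneOn_of_le_succ Set.ordConnected_Iic fun k _ _ hk => ?_
    rw [Set.mem_Iic, Nat.succ_eq_succ, Nat.succ_eq_add_one] at hk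
    rw [Nat.succ_eq_succ, Nat.succ_eq_add_one, coeff_gammaSum, coeff_gammaSum]
    refine Finset.sum_le_sum fun i _ => mul_le_mul_of_nonneg_left ?_ (Nat.cast_nonneg _)
    by_cases hik : i ≤ k
    · rw [if_pos hik, if_pos (by omega), show k + 1 - i = k - i + 1 by omega]
      exact_mod_cast choose_le_succ_of_lt_half (by omega)
    · rw [if_neg hik]
      split_ifs <;> positivity
  · refine antitoneOn_of_succ_le Set.ordConnected_Ici fun k _ hk _ => ?_
    rw [Set.mem_Ici] at hk
    rw [Nat.succ_eq_succ, Nat.succ_eq_add_one, coeff_gammaSum, coeff_gammaSum]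
    refine Finset.sum_le_sum fun i _ => ?_
    rcases lt_or_ge n (2 * i) with h | h
    -- Only 2i ≤ n gives a summand centred at n/2; beyond that the coefficient is zero.
    · simp [gammaNum_eq_zero h]
    · refine mul_le_mul_of_nonneg_left ?_ (Nat.cast_nonneg _)
      rw [if_pos (by omega), if_pos (by omega), show k + 1 - i = k - i + 1 by omega]
      exact_mod_cast choose_succ_le_of_half_le (by omega)

end LocalGamma

theorem theorem1p4 {V : Type*} [Fintype V] [DecidableEq V] (n : ℕ)
    (hn : Fintype.card V = n) :
    (∃! ξ : Fin (n / 2 + 1) → ℤ,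
      LocalGamma.IsGammaVector n (LocalGamma.baryLocalHPoly V) ξ) ∧
    (∀ ξ : Fin (n / 2 + 1) → ℤ,
      LocalGamma.IsGammaVector n (LocalGamma.baryLocalHPoly V) ξ →
      ∀ i : Fin (n / 2 + 1),
        ξ i = ({w : Equiv.Perm (Fin n) | LocalGamma.runs w = i ∧
            ∀ S, LocalGamma.IsRun w S → S.card ≠ 1}.ncard : ℤ) ∧
        ξ i = ({w : Equiv.Perm (Fin n) | w ∈ derangements (Fin n) ∧ LocalGamma.exc w = i ∧
            ∀ j, ¬ LocalGamma.IsDoubleExcedance w j}.ncard : ℤ) ∧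
        ξ i = ({w : Equiv.Perm (Fin n) | LocalGamma.des w = i ∧
            (∀ j, ¬ LocalGamma.IsDoubleDescent w j) ∧
            ∀ j, LocalGamma.IsLeftToRightMax w j → LocalGamma.IsDescent w j}.ncard : ℤ) ∧
        0 ≤ ξ i) ∧
    LocalGamma.IsUnimodal (LocalGamma.derangementPoly n) := by
  have hγ := LocalGamma.isGammaVector_gammaSum n
  rw [LocalGamma.baryLocalHPoly_eq, hn, LocalGamma.derangementPoly_eq]
  refine ⟨⟨_, hγ, fun ζ hζ => hζ.unique hγ⟩, fun ξ hξ i => ?_, LocalGamma.isUnimodal_gammaSum n⟩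
  have hi : (i : ℕ) ≤ n := by
    have := i.2
    omega
  rw [hξ.unique hγ, LocalGamma.ncard_runs hi, LocalGamma.ncard_derangements hi,
    LocalGamma.ncard_descents hi]
  exact ⟨rfl, rfl, rfl, Nat.cast_nonneg _⟩
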